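/- Let $n\ge 1$ and $m\ge 0$ be integers and let $$\varepsilon=(H_{2^n}-1)\left(1-\frac{2^n}{2^n-1}\int_0^1\left(1-u^{2^n-1}\right)^{2^m}\,du\right),\qquad H_N=\sum_{i=1}^N\frac1i .$$ An $n$-qubit state is a unit vector $|\psi\rangle\in\mathbb C^{\{0,1\}^n}$. The Haar measure over $U(2^n)$ is its invariant probability measure, and the Haar measure over $n$-qubit states is the law of $U|0^n\rangle$ for Haar-random $U$. In a randomized one-way protocol with $m$ bits of classical communication, Alice receives a state $|\psi\rangle$ and Bob a unitary $U\in U(2^n)$; they share randomness independent of the inputs; Alice sends Bob a message $x\in\{0,1\}^m$ depending only on $|\psi\rangle$ and the shared randomness; Bob outputs $z\in\{0,1\}^n$ depending only on $x$, $U$ and the shared randomness. For probability distributions $\mathcal S$ over $n$-qubit states and $\mathcal U$ over $U(2^n)$, the protocol solves $\varepsilon$-DXHOG with respect to $(\mathcal S,\mathcal U)$ if $$\mathbb E\left[|\langle z|U|\psi\rangle|^2\right]\ge\frac{1+\varepsilon}{2^n},$$ where $|\psi\rangle\sim\mathcal S$ and $U\sim\mathcal U$ are independent and the expectation is also over the shared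 randomness. The random-codebook protocol: the shared randomness consists of $2^m$ independent Haar-random $n$-qubit states $\{|\varphi_x\rangle\}_{x\in\{0,1\}^m}$; Alice sends an $x$ that maximizes $|\langle\varphi_x|\psi\rangle|^2$; Bob outputs a $z$ that maximizes $|\langle z|U|\varphi_x\rangle|^2$ (ties are broken by any measurable rule; such rules exist). Its re-randomized version: Alice and Bob additionally share an independent Haar-random $V\in U(2^n)$ and run the random-codebook protocol on the inputs $V|\psi\rangle$ and $UV^\dagger$. Then the following hold. 1. If $\mathcal U$ is the Haar measure over $U(2^n)$ and $\mathcal S$ is any probability distribution over $n$-qubit states, the random-codebook protocol solves $\varepsilon$-DXHOG with respect to $(\mathcal S,\mathcal U)$. 2. If $\mathcal S$ is the Haar measure over $n$-qubit states and $\mathcal U$ is any probability distribution over $U(2^n)$, the re-randomized random-codebook protocol solves $\varepsilon$-DXHOG with respect to $(\mathcal S,\mathcal U)$. In particular, some protocol with $m$ bits of communication does. -/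

import Mathlib

open MeasureTheory

namespace DXHOG

/-- Computational basis labels `z ∈ {0,1}ⁿ`. -/
abbrev Bits (n : ℕ) : Type := Fin n → Bool

/-- (Classical descriptions of) `n`-qubit states: unit vectors of `ℂ^{{0,1}ⁿ}` with its Euclidean
norm. It carries the Borel σ-algebra. -/
abbrev QState (n : ℕ) : Type := Metric.sphere (0 : EuclideanSpace ℂ (Bits n)) 1

/-- The unitary group `U(2ⁿ)`, acting on `ℂ^{{0,1}ⁿ}`. -/
abbrev QUnitary (n : ℕ) : Type := Matrix.unitaryGroup (Bits n) ℂ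

noncomputable instance instMeasurableSpaceQUnitary (n : ℕ) : MeasurableSpace (QUnitary n) := borel _

instance instBorelSpaceQUnitary (n : ℕ) : BorelSpace (QUnitary n) := ⟨rfl⟩

instance instSecondCountableQUnitary (n : ℕ) : SecondCountableTopology (QUnitary n) := by
  have : SecondCountableTopology (Matrix (Bits n) (Bits n) ℂ) :=
    inferInstanceAs (SecondCountableTopology (Bits n → Bits n → ℂ))
  exact inferInstanceAs
    (SecondCountableTopology ((Matrix.unitaryGroup (Bits n) ℂ : Set (Matrix (Bits n) (Bits n) ℂ))))

instance instCompactSpaceQUnitary (n : ℕ) : CompactSpace (QUnitary n) := by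
  have hK : IsCompact (Set.univ.pi fun _ : Bits n => Set.univ.pi fun _ : Bits n =>
      Metric.closedBall (0 : ℂ) 1) :=
    isCompact_univ_pi fun _ => isCompact_univ_pi fun _ => isCompact_closedBall _ _
  have hC : IsClosed {A : Matrix (Bits n) (Bits n) ℂ | A * star A = 1} :=
    isClosed_eq (continuous_id.mul continuous_star) continuous_const
  have hT : IsCompact {A : Matrix (Bits n) (Bits n) ℂ | A * star A = 1} := by
    refine IsCompact.of_isClosed_subset (X := Matrix (Bits n) (Bits n) ℂ) hK hC ?_
    intro A hA i _ j _
    have h := entry_norm_bound_of_unitary (Matrix.mem_unitaryGroup_iff.mpr hA) i j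
    simpa using h
  have hE : {A : Matrix (Bits n) (Bits n) ℂ | A * star A = 1} =
      (Matrix.unitaryGroup (Bits n) ℂ : Set (Matrix (Bits n) (Bits n) ℂ)) := by
    ext A
    exact Matrix.mem_unitaryGroup_iff.symm
  rw [hE] at hT
  exact isCompact_iff_compactSpace.mp hT

/-- The Haar measure over `U(2ⁿ)`: the invariant Borel measure of total mass `1`. -/
noncomputable def haarUnitary (n : ℕ) : Measure (QUnitary n) :=
  Measure.haarMeasure (⊤ : TopologicalSpace.PositiveCompacts (QUnitary n))

instance instIsProbabilityMeasureHaarUnitary (n : ℕ) : IsProbabilityMeasure (haarUnitary n) := by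
  constructor
  have h := Measure.haarMeasure_self (K₀ := (⊤ : TopologicalSpace.PositiveCompacts (QUnitary n)))
  simpa [haarUnitary] using h

theorem norm_toLp_mulVec {n : ℕ} (U : QUnitary n) (v : EuclideanSpace ℂ (Bits n)) :
    ‖(WithLp.toLp 2 (U.1.mulVec v.ofLp) : EuclideanSpace ℂ (Bits n))‖ = ‖v‖ := by
  have h := Matrix.mem_unitaryGroup_iff'.mp U.2
  have key : star (U.1.mulVec v.ofLp) ⬝ᵥ U.1.mulVec v.ofLp = star v.ofLp ⬝ᵥ v.ofLp := by
    rw [Matrix.star_mulVec, Matrix.dotProduct_mulVec, Matrix.vecMul_vecMul,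
      ← Matrix.star_eq_conjTranspose, h, Matrix.vecMul_one]
  have e : ∀ w : EuclideanSpace ℂ (Bits n),
      (star w.ofLp ⬝ᵥ w.ofLp : ℂ) = ((‖w‖ ^ 2 : ℝ) : ℂ) := by
    intro w
    rw [EuclideanSpace.norm_sq_eq]
    simp [dotProduct, Complex.conj_mul']
  have h2 := (e (WithLp.toLp 2 (U.1.mulVec v.ofLp))).symm.trans (key.trans (e v))
  have h3 : ‖(WithLp.toLp 2 (U.1.mulVec v.ofLp) : EuclideanSpace ℂ (Bits n))‖ ^ 2 = ‖v‖ ^ 2 := by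
    exact_mod_cast h2
  exact (pow_left_inj₀ (norm_nonneg _) (norm_nonneg _) two_ne_zero).mp h3

/-- The state `U|ψ⟩`. -/
noncomputable def applyU {n : ℕ} (U : QUnitary n) (ψ : QState n) : QState n :=
  ⟨WithLp.toLp 2 (U.1.mulVec ψ.1.ofLp), by
    rw [mem_sphere_zero_iff_norm, norm_toLp_mulVec]; exact mem_sphere_zero_iff_norm.mp ψ.2⟩

theorem continuous_applyU (n : ℕ) :
    Continuous (fun p : QUnitary n × QState n => applyU p.1 p.2) := by
  refine Continuous.subtype_mk ((PiLp.continuous_toLp 2 _).comp ?_) _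
  exact (continuous_subtype_val.comp continuous_fst).matrix_mulVec
    ((PiLp.continuous_ofLp 2 _).comp (continuous_subtype_val.comp continuous_snd))

/-- The computational basis state `|0ⁿ⟩`. -/
noncomputable def zeroState (n : ℕ) : QState n :=
  ⟨EuclideanSpace.single (fun _ => false) 1, by simp⟩

/-- The Haar measure over `n`-qubit states: the law of `U|0ⁿ⟩` for Haar-random `U`. -/
noncomputable def haarState (n : ℕ) : Measure (QState n) :=
  (haarUnitary n).map fun U => applyU U (zeroState n)

/-- The outcome probability `|⟨z|U|ψ⟩|²`. -/
noncomputable def outcomeProb {n : ℕ} (z : Bits n) (U : QUnitary n) (ψ : QState n) : ℝ :=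
  ‖(applyU U ψ).1 z‖ ^ 2

/-- The fidelity `|⟨φ|ψ⟩|²`. -/
noncomputable def fidelity {n : ℕ} (φ ψ : QState n) : ℝ :=
  ‖inner ℂ φ.1 ψ.1‖ ^ 2

/-- A randomized one-way classical protocol with `m` bits of communication, for inputs
`|ψ⟩` (Alice) and `U ∈ U(2ⁿ)` (Bob), whose shared randomness takes values in `Ω`. Alice's message
depends on the randomness and on `|ψ⟩` only; Bob's output depends on the randomness, on the
`m`-bit message and on `U` only. -/
structure Protocol (n m : ℕ) (Ω : Type) [MeasurableSpace Ω] where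
  /-- the law of the shared randomness -/
  randomness : Measure Ω
  isProbabilityMeasure_randomness : IsProbabilityMeasure randomness
  /-- Alice's `m`-bit message -/
  alice : Ω → QState n → Bits m
  /-- Bob's `n`-bit output -/
  bob : Ω → Bits m → QUnitary n → Bits n
  measurable_alice : Measurable fun p : Ω × QState n => alice p.1 p.2
  measurable_bob : ∀ x : Bits m, Measurable fun p : Ω × QUnitary n => bob p.1 x p.2

/-- The string `z` output by the protocol. -/
def Protocol.output {n m : ℕ} {Ω : Type} [MeasurableSpace Ω] (P : Protocol n m Ω)
    (ω : Ω) (ψ : QState n) (U : QUnitary n) : Bits n :=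
  P.bob ω (P.alice ω ψ) U

/-- The protocol solves `ε`-DXHOG with respect to independent `|ψ⟩ ∼ 𝒮` and `U ∼ 𝒰`:
`𝔼 |⟨z|U|ψ⟩|² ≥ (1 + ε) / 2ⁿ`, averaging over the randomness of the protocol as well. -/
def Protocol.SolvesDXHOG {n m : ℕ} {Ω : Type} [MeasurableSpace Ω] (P : Protocol n m Ω)
    (𝒮 : Measure (QState n)) (𝒰 : Measure (QUnitary n)) (ε : ℝ) : Prop :=
  (1 + ε) / 2 ^ n ≤
    ∫ p : Ω × QState n × QUnitary n, outcomeProb (P.output p.1 p.2.1 p.2.2) p.2.2 p.2.1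
      ∂(P.randomness.prod (𝒮.prod 𝒰))

/-- A codebook `{|φ_x⟩}`, one state for every `m`-bit string `x`. -/
abbrev Codebook (n m : ℕ) : Type := Bits m → QState n

/-- `P` is the random-codebook protocol (for some way of breaking ties): the shared randomness is a
codebook of independent Haar-random states; Alice sends an `x` maximizing `|⟨φ_x|ψ⟩|²`;
Bob outputs a `z` maximizing `|⟨z|U|φ_x⟩|²`. -/
structure IsRandomCodebook {n m : ℕ} (P : Protocol n m (Codebook n m)) : Prop where
  randomness_eq : P.randomness = Measure.pi fun _ : Bits m => haarState n
  alice_max : ∀ (φ : Codebook n m) (ψ : QState n) (x : Bits m),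
    fidelity (φ x) ψ ≤ fidelity (φ (P.alice φ ψ)) ψ
  bob_max : ∀ (φ : Codebook n m) (x : Bits m) (U : QUnitary n) (z : Bits n),
    outcomeProb z U (φ x) ≤ outcomeProb (P.bob φ x U) U (φ x)

/-- Re-randomization: Alice and Bob share in addition an independent Haar-random `V ∈ U(2ⁿ)` and run
`P` on the inputs `V|ψ⟩` and `UV†`. -/
noncomputable def Protocol.rerandomize {n m : ℕ} {Ω : Type} [MeasurableSpace Ω]
    (P : Protocol n m Ω) : Protocol n m (Ω × QUnitary n) where
  randomness := P.randomness.prod (haarUnitary n)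
  isProbabilityMeasure_randomness := by
    have := P.isProbabilityMeasure_randomness
    infer_instance
  alice ω ψ := P.alice ω.1 (applyU ω.2 ψ)
  bob ω x U := P.bob ω.1 x (U * star ω.2)
  measurable_alice := by
    have h : Measurable fun p : (Ω × QUnitary n) × QState n => applyU p.1.2 p.2 :=
      (continuous_applyU n).measurable.comp (measurable_fst.snd.prodMk measurable_snd)
    exact P.measurable_alice.comp (measurable_fst.fst.prodMk h)
  measurable_bob x := by
    have hc : Continuous fun q : QUnitary n × QUnitary n => q.1 * star q.2 :=
      continuous_fst.mul continuous_snd.star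
    have h : Measurable fun p : (Ω × QUnitary n) × QUnitary n => p.2 * star p.1.2 :=
      hc.measurable.comp (measurable_snd.prodMk measurable_fst.snd)
    exact (P.measurable_bob x).comp (measurable_fst.fst.prodMk h)

/-- `(H_N - 1) (1 - N/(N-1) ∫₀¹ (1 - u^(N-1))^(2^m) du)` with `N = 2ⁿ`, where `H_N` is the `N`-th
harmonic number. -/
noncomputable def codebookEps (n m : ℕ) : ℝ :=
  ((harmonic (2 ^ n) : ℚ) - 1 : ℝ) *
    (1 - (2 : ℝ) ^ n / ((2 : ℝ) ^ n - 1) * ∫ u in (0 : ℝ)..1, (1 - u ^ (2 ^ n - 1)) ^ (2 ^ m))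

end DXHOG

/-!
Write `N = 2 ^ n` and `M = 2 ^ m`. The expected score of the random-codebook protocol against a
Haar-random unitary is computed exactly, for every input state `ψ`, and equals `(1 + ε) / N`.

*Bob's side.* Fix the codeword `φ` that Alice points to and let `F` be its fidelity with `ψ`. Given
`χ = Uφ`, the component of `Uψ` along `χ` has weight `F`, and the rest is spread evenly over the
orthogonal complement of `χ`. So an outcome `z` chosen from `χ` has expected probability
`F |χ_z|² + (1 - F) (1 - |χ_z|²) / (N - 1)` (`integral_mul_norm_sq_applyU`; instead of conditional
expectations, the proof uses invariance of Haar measure under sign flips and transpositions of the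
columns of `U`). Bob takes the largest `|χ_z|²`, whose mean is `H_N / N`
(`integral_iSup_norm_sq_haarState`). Ties have probability zero, so it does not matter how he breaks
them (`integral_outcomeProb_of_forall_le`).

*Alice's side.* The fidelity of `ψ` with one Haar-random codeword exceeds `t` with probability
`(1 - t) ^ (N - 1)`. Integrating the tail of the maximum over `M` independent codewords gives
`𝔼 F = 1 - ∫₀¹ (1 - u ^ (N - 1)) ^ M du` (`integral_iSup_fidelity`). The score is affine in `F`, so
this determines its mean.

*Laws of amplitudes.* Both facts about Haar-random states come from Gaussian vectors. A vector of
independent standard complex Gaussians has a unitarily invariant law, so its direction is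
Haar-random and independent of its length, while its squared moduli are independent exponentials
(`lintegral_expVector_eq_lintegral_haarState`). The maximum of `N` independent exponentials has mean
`H_N`, their sum has mean `N`, and the event `x₀ > t ∑ x` is a Laplace transform.

*Re-randomization.* If `ψ` and `V` are independent and Haar-random and `U` is independent of them,
then `Vψ` and `UV†` are independent and Haar-random (`measurePreserving_rerandomize`), while
`|⟨z|U|ψ⟩|² = |⟨z|UV†|Vψ⟩|²`. So the second claim is the first one with a Haar-random state.
-/

namespace DXHOG

/-! ### Haar measures on unitaries and states -/

instance instIsHaarMeasureHaarUnitary (n : ℕ) : (haarUnitary n).IsHaarMeasure := by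
  unfold haarUnitary; infer_instance

/-- A right translate of the Haar measure is again left-invariant, so uniqueness applies. -/
instance instIsMulRightInvariantHaarUnitary (n : ℕ) : (haarUnitary n).IsMulRightInvariant := by
  refine ⟨fun V => ?_⟩
  have : IsProbabilityMeasure ((haarUnitary n).map (· * V)) :=
    Measure.isProbabilityMeasure_map (measurable_mul_const V).aemeasurable
  exact Measure.isHaarMeasure_eq_of_isProbabilityMeasure _ _

/-- The image under inversion is left-invariant because the Haar measure is right-invariant. -/
instance instIsInvInvariantHaarUnitary (n : ℕ) : (haarUnitary n).IsInvInvariant := by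
  refine ⟨?_⟩
  have : IsProbabilityMeasure (haarUnitary n).inv :=
    Measure.isProbabilityMeasure_map measurable_inv.aemeasurable
  have h := Measure.isMulInvariant_eq_smul_of_compactSpace (haarUnitary n).inv (haarUnitary n)
  have h1 := congrArg (fun μ : Measure (QUnitary n) => μ Set.univ) h
  simp only [measure_univ, Measure.smul_apply, ENNReal.smul_def, smul_eq_mul, mul_one] at h1
  have h2 : (haarUnitary n).inv.haarScalarFactor (haarUnitary n) = 1 := by exact_mod_cast h1.symm
  rw [h, h2, one_smul]

theorem applyU_mul {n : ℕ} (U V : QUnitary n) (ψ : QState n) :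
    applyU (U * V) ψ = applyU U (applyU V ψ) := by
  ext z
  simp [applyU, Matrix.mulVec_mulVec]

theorem applyU_one {n : ℕ} (ψ : QState n) : applyU 1 ψ = ψ := by
  ext z
  simp [applyU]

theorem applyU_inv_applyU {n : ℕ} (U : QUnitary n) (ψ : QState n) :
    applyU U⁻¹ (applyU U ψ) = ψ := by
  rw [← applyU_mul, inv_mul_cancel, applyU_one]

theorem applyU_apply {n : ℕ} (U : QUnitary n) (ψ : QState n) (z : Bits n) :
    (applyU U ψ).1 z = ∑ j, U.1 z j * ψ.1 j := rfl

theorem applyU_zeroState_apply {n : ℕ} (U : QUnitary n) (z : Bits n) :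
    (applyU U (zeroState n)).1 z = U.1 z fun _ => false := by
  simp [applyU_apply, zeroState]

theorem measurable_applyU_left {n : ℕ} (ψ : QState n) :
    Measurable fun U : QUnitary n => applyU U ψ :=
  ((continuous_applyU n).comp (Continuous.prodMk_left ψ)).measurable

theorem measurable_applyU_right {n : ℕ} (U : QUnitary n) :
    Measurable fun ψ : QState n => applyU U ψ :=
  ((continuous_applyU n).comp (Continuous.prodMk_right U)).measurable

theorem sum_norm_sq_state {n : ℕ} (ψ : QState n) : ∑ z, ‖ψ.1 z‖ ^ 2 = 1 := by
  rw [← EuclideanSpace.norm_sq_eq, mem_sphere_zero_iff_norm.mp ψ.2, one_pow]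

/-- The unitary group acts transitively on states: a state is completed to an orthonormal basis. -/
theorem exists_applyU_zeroState {n : ℕ} (ψ : QState n) : ∃ U, applyU U (zeroState n) = ψ := by
  have hv : Orthonormal ℂ (({fun _ => false} : Set (Bits n)).domRestrict
      fun _ : Bits n => ψ.1) := by
    refine ⟨fun i => mem_sphere_zero_iff_norm.mp ψ.2, fun i j hij => ?_⟩
    exact absurd (Subsingleton.elim i j) hij
  obtain ⟨b, hb⟩ := Orthonormal.exists_orthonormalBasis_extension_of_card_eq
    (𝕜 := ℂ) (E := EuclideanSpace ℂ (Bits n)) finrank_euclideanSpace hv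
  refine ⟨⟨(EuclideanSpace.basisFun (Bits n) ℂ).toBasis.toMatrix b,
    OrthonormalBasis.toMatrix_orthonormalBasis_mem_unitary _ _⟩, ?_⟩
  ext z
  rw [applyU_zeroState_apply, ← hb _ rfl]
  simp [Module.Basis.toMatrix_apply]

/-- The orbit of any state under a Haar-random unitary is Haar-random. -/
theorem map_applyU_haarUnitary {n : ℕ} (ψ : QState n) :
    (haarUnitary n).map (fun U => applyU U ψ) = haarState n := by
  obtain ⟨W, rfl⟩ := exists_applyU_zeroState ψ
  conv_rhs => rw [haarState, ← map_mul_right_eq_self (haarUnitary n) W]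
  rw [Measure.map_map (measurable_applyU_left _) (measurable_mul_const W)]
  simp only [Function.comp_def, applyU_mul]

instance instIsProbabilityMeasureHaarState (n : ℕ) : IsProbabilityMeasure (haarState n) :=
  Measure.isProbabilityMeasure_map (measurable_applyU_left _).aemeasurable

theorem map_applyU_haarState {n : ℕ} (U : QUnitary n) :
    (haarState n).map (fun ψ => applyU U ψ) = haarState n := by
  conv_rhs => rw [haarState, ← map_mul_left_eq_self (haarUnitary n) U]
  rw [haarState, Measure.map_map (measurable_applyU_right _) (measurable_applyU_left _),
    Measure.map_map (measurable_applyU_left _) (measurable_const_mul U)]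
  simp only [Function.comp_def, applyU_mul]

theorem fidelity_eq {n : ℕ} (φ ψ : QState n) :
    fidelity φ ψ = ‖(star φ.1.ofLp ⬝ᵥ ψ.1.ofLp : ℂ)‖ ^ 2 := by
  rw [fidelity, EuclideanSpace.inner_eq_star_dotProduct, dotProduct_comm]

theorem fidelity_applyU {n : ℕ} (U : QUnitary n) (φ ψ : QState n) :
    fidelity (applyU U φ) (applyU U ψ) = fidelity φ ψ := by
  rw [fidelity_eq, fidelity_eq]
  simp only [applyU]
  rw [Matrix.star_mulVec, Matrix.dotProduct_mulVec, Matrix.vecMul_vecMul,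
      ← Matrix.star_eq_conjTranspose, Matrix.mem_unitaryGroup_iff'.mp U.2, Matrix.vecMul_one]

theorem fidelity_comm {n : ℕ} (φ ψ : QState n) : fidelity φ ψ = fidelity ψ φ := by
  rw [fidelity, fidelity, norm_inner_symm]

theorem fidelity_zeroState {n : ℕ} (ψ : QState n) :
    fidelity (zeroState n) ψ = ‖ψ.1 fun _ => false‖ ^ 2 := by
  simp only [fidelity, zeroState]
  rw [EuclideanSpace.inner_single_left]
  simp

theorem fidelity_nonneg {n : ℕ} (φ ψ : QState n) : 0 ≤ fidelity φ ψ := sq_nonneg _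

theorem fidelity_le_one {n : ℕ} (φ ψ : QState n) : fidelity φ ψ ≤ 1 := by
  have h := norm_inner_le_norm (𝕜 := ℂ) φ.1 ψ.1
  rw [mem_sphere_zero_iff_norm.mp φ.2, mem_sphere_zero_iff_norm.mp ψ.2, mul_one] at h
  exact pow_le_one₀ (norm_nonneg _) h

theorem continuous_state_apply {n : ℕ} (z : Bits n) :
    Continuous fun ψ : QState n => ψ.1 z := by
  fun_prop

theorem norm_sq_state_le_one {n : ℕ} (z : Bits n) (ψ : QState n) : ‖ψ.1 z‖ ^ 2 ≤ 1 := by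
  refine le_of_le_of_eq ?_ (sum_norm_sq_state ψ)
  exact Finset.single_le_sum (f := fun z => ‖ψ.1 z‖ ^ 2) (fun _ _ => sq_nonneg _)
    (Finset.mem_univ z)

/-! ### Complex Gaussian vectors -/

open ProbabilityTheory in
theorem lintegral_expMeasure_one {h : ℝ → ENNReal} (hh : Measurable h) :
    ∫⁻ x, h x ∂expMeasure 1 = ∫⁻ x in Set.Ioi 0, ENNReal.ofReal (Real.exp (-x)) * h x := by
  have e : expMeasure 1 = volume.withDensity (exponentialPDF 1) := rfl
  have hm : Measurable (exponentialPDF 1) := (measurable_exponentialPDFReal 1).ennreal_ofReal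
  rw [e, lintegral_withDensity_eq_lintegral_mul _ hm hh,
    setLIntegral_congr Ioi_ae_eq_Ici, ← lintegral_indicator measurableSet_Ici]
  refine lintegral_congr fun x => ?_
  by_cases hx : 0 ≤ x
  · simp [exponentialPDF_of_nonneg hx, hx]
  · simp [exponentialPDF_of_neg (not_le.mp hx), hx]

instance : IsProbabilityMeasure (ProbabilityTheory.expMeasure 1) :=
  ProbabilityTheory.isProbabilityMeasure_expMeasure one_pos

theorem expMeasure_one_Ioi {t : ℝ} (ht : 0 ≤ t) :
    ProbabilityTheory.expMeasure 1 (Set.Ioi t) = ENNReal.ofReal (Real.exp (-t)) := by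
  have h := ProbabilityTheory.cdf_expMeasure_eq one_pos t
  rw [ProbabilityTheory.cdf_eq_real, if_pos ht, one_mul] at h
  rw [← Set.compl_Iic, ← ofReal_measureReal, probReal_compl_eq_one_sub measurableSet_Iic, h,
    sub_sub_cancel]

theorem expMeasure_one_Ioi_zero : ProbabilityTheory.expMeasure 1 (Set.Ioi 0) = 1 := by
  simp [expMeasure_one_Ioi le_rfl]

/-- Polar coordinates followed by the substitution `s = r²`. -/
theorem lintegral_complex_gaussian {h : ℝ → ENNReal} (hh : Measurable h) :
    ∫⁻ z : ℂ, ENNReal.ofReal (Real.exp (-‖z‖ ^ 2) / Real.pi) * h (‖z‖ ^ 2) =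
      ∫⁻ x, h x ∂ProbabilityTheory.expMeasure 1 := by
  have himg : (fun r : ℝ => r ^ 2) '' Set.Ioi 0 = Set.Ioi 0 := by
    ext s
    refine ⟨?_, fun hs => ⟨√s, Real.sqrt_pos.mpr hs, Real.sq_sqrt (le_of_lt hs)⟩⟩
    rintro ⟨r, hr, rfl⟩
    exact pow_pos (Set.mem_Ioi.mp hr) 2
  have hsub := lintegral_image_eq_lintegral_abs_deriv_mul (measurableSet_Ioi (a := (0 : ℝ)))
    (f := fun r => r ^ 2) (f' := fun r => 2 * r)
    (fun r _ => by simpa using (hasDerivAt_pow 2 r).hasDerivWithinAt)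
    (fun a ha b hb hab => (pow_left_inj₀ (le_of_lt ha) (le_of_lt hb) two_ne_zero).mp hab)
    (fun x => ENNReal.ofReal (Real.exp (-x)) * h x)
  rw [himg] at hsub
  rw [lintegral_expMeasure_one hh, hsub, ← Complex.lintegral_comp_polarCoord_symm,
    polarCoord_target, Measure.volume_eq_prod, ← Measure.prod_restrict]
  have hm : Measurable fun r : ℝ => ENNReal.ofReal r *
      (ENNReal.ofReal (Real.exp (-r ^ 2) / Real.pi) * h (r ^ 2)) := by fun_prop
  calc _ = ∫⁻ p : ℝ × ℝ, (ENNReal.ofReal p.1 *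
        (ENNReal.ofReal (Real.exp (-p.1 ^ 2) / Real.pi) * h (p.1 ^ 2))) * 1
        ∂(volume.restrict (Set.Ioi 0)).prod (volume.restrict (Set.Ioo (-Real.pi) Real.pi)) := by
        simp
    _ = _ := by
        rw [lintegral_prod_mul (f := fun r => ENNReal.ofReal r *
          (ENNReal.ofReal (Real.exp (-r ^ 2) / Real.pi) * h (r ^ 2))) hm.aemeasurable
          aemeasurable_const, ← lintegral_mul_const _ hm]
        refine setLIntegral_congr_fun measurableSet_Ioi fun r hr => ?_
        have hr : 0 < r := hr
        simp only [lintegral_const, Measure.restrict_apply_univ, Real.volume_Ioo, one_mul]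
        rw [← mul_assoc, ← mul_assoc, mul_right_comm, abs_of_pos (by positivity),
          ← ENNReal.ofReal_mul hr.le, ← ENNReal.ofReal_mul (by positivity),
          ← ENNReal.ofReal_mul (by positivity)]
        congr 2
        field_simp
        ring

/-- The standard complex Gaussian law, with density `exp (-|z|²) / π`. -/
noncomputable def complexGaussian : Measure ℂ :=
  volume.withDensity fun z => ENNReal.ofReal (Real.exp (-‖z‖ ^ 2) / Real.pi)

theorem map_norm_sq_complexGaussian :
    complexGaussian.map (fun z => ‖z‖ ^ 2) = ProbabilityTheory.expMeasure 1 := by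
  refine Measure.ext_of_lintegral _ fun h hh => ?_
  rw [lintegral_map hh (by fun_prop), complexGaussian,
    lintegral_withDensity_eq_lintegral_mul _ (by fun_prop) (by fun_prop)]
  exact lintegral_complex_gaussian hh

instance instIsProbabilityMeasureComplexGaussian : IsProbabilityMeasure complexGaussian := by
  refine ⟨?_⟩
  have h := congrArg (fun μ : Measure ℝ => μ Set.univ) map_norm_sq_complexGaussian
  simpa [Measure.map_apply (show Measurable fun z : ℂ => ‖z‖ ^ 2 by fun_prop)
    MeasurableSet.univ] using h

section

variable {ι : Type*} [Fintype ι]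

/-- The law of a vector of independent standard complex Gaussians. -/
noncomputable def gaussianVector (ι : Type*) [Fintype ι] : Measure (ι → ℂ) :=
  Measure.pi fun _ => complexGaussian

instance : IsProbabilityMeasure (gaussianVector ι) := by
  unfold gaussianVector; infer_instance

/-- The law of independent exponential variables of rate one. -/
noncomputable def expVector (ι : Type*) [Fintype ι] : Measure (ι → ℝ) :=
  Measure.pi fun _ => ProbabilityTheory.expMeasure 1

instance : IsProbabilityMeasure (expVector ι) := by
  unfold expVector; infer_instance

/-- The squared moduli of independent standard complex Gaussians are independent exponentials. -/
theorem map_norm_sq_gaussianVector :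
    (gaussianVector ι).map (fun v i => ‖v i‖ ^ 2) = expVector ι := by
  have : IsProbabilityMeasure (complexGaussian.map fun z => ‖z‖ ^ 2) := by
    rw [map_norm_sq_complexGaussian]; infer_instance
  rw [gaussianVector, Measure.pi_map_pi (f := fun _ z => ‖z‖ ^ 2) (fun _ => by fun_prop),
    map_norm_sq_complexGaussian, expVector]

theorem integrable_complexGaussian_density :
    Integrable fun z : ℂ => Real.exp (-‖z‖ ^ 2) / Real.pi := by
  refine ⟨by fun_prop, ?_⟩
  rw [hasFiniteIntegral_iff_ofReal (Filter.Eventually.of_forall fun z => by positivity)]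
  have h : complexGaussian Set.univ = 1 := measure_univ
  rw [complexGaussian, withDensity_apply _ MeasurableSet.univ, Measure.restrict_univ] at h
  rw [h]
  exact ENNReal.one_lt_top

theorem gaussianVector_eq_withDensity :
    gaussianVector ι = volume.withDensity fun v : ι → ℂ =>
      ENNReal.ofReal (∏ i, Real.exp (-‖v i‖ ^ 2) / Real.pi) := by
  refine Measure.pi_eq fun s hs => ?_
  rw [withDensity_apply _ (MeasurableSet.univ_pi hs), volume_pi, Measure.restrict_pi_pi,
    ← ofReal_integral_eq_lintegral_ofReal]
  · rw [integral_fintype_prod_eq_prod (f := fun _ z => Real.exp (-‖z‖ ^ 2) / Real.pi),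
      ENNReal.ofReal_prod_of_nonneg fun i _ => integral_nonneg fun z => by positivity]
    refine Finset.prod_congr rfl fun i _ => ?_
    rw [complexGaussian, withDensity_apply _ (hs i), ofReal_integral_eq_lintegral_ofReal
      integrable_complexGaussian_density.integrableOn
      (Filter.Eventually.of_forall fun z => by positivity)]
  · exact Integrable.fintype_prod (f := fun _ z => Real.exp (-‖z‖ ^ 2) / Real.pi)
      fun i => integrable_complexGaussian_density.integrableOn
  · exact Filter.Eventually.of_forall fun v => Finset.prod_nonneg fun i _ => by positivity

theorem sum_norm_sq_mulVec [DecidableEq ι] (U : Matrix.unitaryGroup ι ℂ) (v : ι → ℂ) :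
    ∑ i, ‖U.1.mulVec v i‖ ^ 2 = ∑ i, ‖v i‖ ^ 2 := by
  have key : star (U.1.mulVec v) ⬝ᵥ U.1.mulVec v = star v ⬝ᵥ v := by
    rw [Matrix.star_mulVec, Matrix.dotProduct_mulVec, Matrix.vecMul_vecMul,
      ← Matrix.star_eq_conjTranspose, Matrix.mem_unitaryGroup_iff'.mp U.2, Matrix.vecMul_one]
  have e : ∀ w : ι → ℂ, (star w ⬝ᵥ w : ℂ) = ((∑ i, ‖w i‖ ^ 2 : ℝ) : ℂ) := by
    intro w
    simp [dotProduct, Complex.conj_mul']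
  rw [e, e] at key
  exact_mod_cast key

theorem measurable_mulVec (A : Matrix ι ι ℂ) : Measurable fun v : ι → ℂ => A.mulVec v :=
  (continuous_const.matrix_mulVec continuous_id).measurable

/-- A unitary scales Lebesgue measure by a constant and preserves the Gaussian density. So it
scales the Gaussian law by that constant, which must be one as the total mass is one. -/
theorem map_mulVec_gaussianVector [DecidableEq ι] (U : Matrix.unitaryGroup ι ℂ) :
    (gaussianVector ι).map (fun v => U.1.mulVec v) = gaussianVector ι := by
  let L : (ι → ℂ) ≃ₗ[ℝ] (ι → ℂ) := (Matrix.toLin'OfInv (Matrix.mem_unitaryGroup_iff'.mp U.2)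
    (Matrix.mem_unitaryGroup_iff.mp U.2)).restrictScalars ℝ
  have hL := Measure.map_linearMap_addHaar_eq_smul_addHaar (volume : Measure (ι → ℂ))
    (f := (L : (ι → ℂ) →ₗ[ℝ] (ι → ℂ))) (LinearEquiv.isUnit_det' L).ne_zero
  have hLU : ⇑(L : (ι → ℂ) →ₗ[ℝ] (ι → ℂ)) = fun v => U.1.mulVec v := rfl
  rw [hLU] at hL
  generalize ENNReal.ofReal _ = c at hL
  have hU : Measurable fun v : ι → ℂ => U.1.mulVec v := measurable_mulVec _
  have hsmul : (gaussianVector ι).map (fun v => U.1.mulVec v) = c • gaussianVector ι := by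
    refine Measure.ext_of_lintegral _ fun h hh => ?_
    have hf : Measurable fun v : ι → ℂ =>
        ENNReal.ofReal (∏ i, Real.exp (-‖v i‖ ^ 2) / Real.pi) := by fun_prop
    have hinv : ∀ v : ι → ℂ, ∏ i, Real.exp (-‖U.1.mulVec v i‖ ^ 2) / Real.pi =
        ∏ i, Real.exp (-‖v i‖ ^ 2) / Real.pi := by
      intro v
      rw [Finset.prod_div_distrib, Finset.prod_div_distrib, ← Real.exp_sum, ← Real.exp_sum,
        Finset.sum_neg_distrib, Finset.sum_neg_distrib, sum_norm_sq_mulVec]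
    have hhU : Measurable fun v : ι → ℂ => h (U.1.mulVec v) := hh.comp hU
    rw [lintegral_map hh hU, lintegral_smul_measure, gaussianVector_eq_withDensity,
      lintegral_withDensity_eq_lintegral_mul _ hf hhU,
      lintegral_withDensity_eq_lintegral_mul _ hf hh, ← lintegral_smul_measure, ← hL,
      lintegral_map (hf.mul hh) hU]
    simp only [Pi.mul_apply, hinv]
  have hc := congrArg (fun μ : Measure (ι → ℂ) => μ Set.univ) hsmul
  simp only [Measure.map_apply hU MeasurableSet.univ, Set.preimage_univ, measure_univ,
    Measure.smul_apply, smul_eq_mul, mul_one] at hc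
  rw [hsmul, ← hc, one_smul]

/-! ### Independent exponential variables -/

theorem lintegral_ofReal_eq_of_hasDerivAt_Ioi {g g' : ℝ → ℝ} {l : ℝ}
    (hd : ∀ x, HasDerivAt g (g' x) x) (hpos : ∀ x ∈ Set.Ioi (0 : ℝ), 0 ≤ g' x)
    (hl : Filter.Tendsto g Filter.atTop (nhds l)) :
    ∫⁻ x in Set.Ioi 0, ENNReal.ofReal (g' x) = ENNReal.ofReal (l - g 0) := by
  have hc : ContinuousWithinAt g (Set.Ici 0) 0 := (hd 0).continuousAt.continuousWithinAt
  rw [← integral_Ioi_of_hasDerivAt_of_nonneg hc (fun x _ => hd x) hpos hl,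
    ofReal_integral_eq_lintegral_ofReal
      (integrableOn_Ioi_deriv_of_nonneg hc (fun x _ => hd x) hpos hl)]
  exact (ae_restrict_iff' measurableSet_Ioi).mpr (Filter.Eventually.of_forall hpos)

/-- The Laplace transform of the exponential law. -/
theorem lintegral_exp_neg_mul_expMeasure {c : ℝ} (hc : 0 ≤ c) :
    ∫⁻ x, ENNReal.ofReal (Real.exp (-(c * x))) ∂ProbabilityTheory.expMeasure 1 =
      ENNReal.ofReal (1 / (1 + c)) := by
  have h1 : 0 < 1 + c := by linarith
  rw [lintegral_expMeasure_one (by fun_prop)]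
  have h := lintegral_ofReal_eq_of_hasDerivAt_Ioi (l := 0)
    (g := fun x => -(Real.exp (-((1 + c) * x)) / (1 + c)))
    (g' := fun x => Real.exp (-((1 + c) * x))) ?_ (fun _ _ => (Real.exp_pos _).le) ?_
  · rw [show 1 / (1 + c) = 0 - -(Real.exp (-((1 + c) * 0)) / (1 + c)) by simp, ← h]
    refine lintegral_congr fun x => ?_
    rw [← ENNReal.ofReal_mul (Real.exp_pos _).le, ← Real.exp_add]
    ring_nf
  · intro x
    have := ((((hasDerivAt_id x).const_mul (1 + c)).neg.exp).div_const (1 + c)).neg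
    refine this.congr_deriv ?_
    change -(Real.exp (-((1 + c) * x)) * -((1 + c) * 1) / (1 + c)) = _
    field_simp
  · rw [← neg_zero, ← zero_div (1 + c)]
    exact ((Real.tendsto_exp_neg_atTop_nhds_zero.comp
      (Filter.tendsto_id.const_mul_atTop h1)).div_const _).neg

theorem ae_pos_expVector : ∀ᵐ x ∂expVector ι, ∀ i, 0 < x i := by
  refine ae_all_iff.mpr fun i => ?_
  have h : ∀ᵐ y ∂ProbabilityTheory.expMeasure 1, 0 < y :=
    (prob_compl_eq_zero_iff measurableSet_Ioi).mpr expMeasure_one_Ioi_zero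
  exact (measurePreserving_eval (fun _ : ι => ProbabilityTheory.expMeasure 1)
    i).quasiMeasurePreserving.ae h

theorem lintegral_coord_expVector (i : ι) :
    ∫⁻ x, ENNReal.ofReal (x i) ∂expVector ι = 1 := by
  rw [lintegral_eq_lintegral_meas_lt _ (ae_pos_expVector.mono fun x hx => (hx i).le)
    (measurable_pi_apply i).aemeasurable]
  have h : ∀ t ∈ Set.Ioi (0 : ℝ), expVector ι {x | t < x i} = ENNReal.ofReal (Real.exp (-t)) := by
    intro t ht
    rw [← expMeasure_one_Ioi (le_of_lt ht)]
    exact (measurePreserving_eval (fun _ : ι => ProbabilityTheory.expMeasure 1) i).measure_preimage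
      measurableSet_Ioi.nullMeasurableSet
  rw [setLIntegral_congr_fun measurableSet_Ioi h,
    lintegral_ofReal_eq_of_hasDerivAt_Ioi (l := 0) (g := fun t => -Real.exp (-t))
      (fun t => ((Real.hasDerivAt_exp (-t)).comp t (hasDerivAt_neg t)).neg.congr_deriv (by ring))
      (fun t _ => (Real.exp_pos _).le)
      (by simpa using Real.tendsto_exp_neg_atTop_nhds_zero.neg)]
  simp

/-- The expected maximum of `N` independent exponentials is the harmonic number `H_N`: the tail
`1 - (1 - exp (-t)) ^ N` has the antiderivative `∑ k < N, (1 - exp (-t)) ^ (k + 1) / (k + 1)`. -/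
theorem lintegral_iSup_expVector [Nonempty ι] :
    ∫⁻ x, ENNReal.ofReal (⨆ i, x i) ∂expVector ι =
      ENNReal.ofReal ((harmonic (Fintype.card ι) : ℚ) : ℝ) := by
  have hbdd : ∀ x : ι → ℝ, BddAbove (Set.range x) := fun x => (Set.finite_range x).bddAbove
  obtain ⟨i₀⟩ := ‹Nonempty ι›
  have : Nonempty ι := ⟨i₀⟩
  rw [lintegral_eq_lintegral_meas_lt _
    (ae_pos_expVector.mono fun x hx => (hx i₀).le.trans (le_ciSup (hbdd x) i₀))
    (Measurable.iSup fun i => measurable_pi_apply i).aemeasurable]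
  have h : ∀ t ∈ Set.Ioi (0 : ℝ), expVector ι {x | t < ⨆ i, x i} =
      ENNReal.ofReal (1 - (1 - Real.exp (-t)) ^ Fintype.card ι) := by
    intro t ht
    have hs : {x : ι → ℝ | t < ⨆ i, x i}ᶜ = Set.univ.pi fun _ => Set.Iic t := by
      ext x
      simp [ciSup_le_iff (hbdd x), Pi.le_def]
    have hIic : ProbabilityTheory.expMeasure 1 (Set.Iic t) =
        ENNReal.ofReal (1 - Real.exp (-t)) := by
      rw [← ofReal_measureReal, ← ProbabilityTheory.cdf_eq_real,
        ProbabilityTheory.cdf_expMeasure_eq one_pos, if_pos (le_of_lt ht), one_mul]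
    have h0 : 0 ≤ 1 - Real.exp (-t) := by
      rw [sub_nonneg, Real.exp_le_one_iff]
      exact neg_nonpos.mpr (le_of_lt ht)
    have hm : MeasurableSet {x : ι → ℝ | t < ⨆ i, x i} :=
      measurableSet_lt measurable_const (Measurable.iSup fun i => measurable_pi_apply i)
    rw [← compl_compl {x : ι → ℝ | t < ⨆ i, x i}, prob_compl_eq_one_sub hm.compl, hs, expVector,
      Measure.pi_pi, Finset.prod_const, hIic, Finset.card_univ, ← ENNReal.ofReal_pow h0,
      ← ENNReal.ofReal_one, ENNReal.ofReal_sub _ (pow_nonneg h0 _)]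
  rw [setLIntegral_congr_fun measurableSet_Ioi h]
  rw [lintegral_ofReal_eq_of_hasDerivAt_Ioi (l := ((harmonic (Fintype.card ι) : ℚ) : ℝ))
    (g := fun t => ∑ k ∈ Finset.range (Fintype.card ι), (1 - Real.exp (-t)) ^ (k + 1) / (k + 1))]
  · simp
  · intro t
    have hd : HasDerivAt (fun t => 1 - Real.exp (-t)) (Real.exp (-t)) t := by
      simpa using ((Real.hasDerivAt_exp (-t)).comp t (hasDerivAt_neg t)).const_sub 1
    have := HasDerivAt.fun_sum (u := Finset.range (Fintype.card ι)) fun k _ =>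
      (hd.pow (k + 1)).div_const ((k : ℝ) + 1)
    refine this.congr_deriv ?_
    have hg := mul_neg_geom_sum (1 - Real.exp (-t)) (Fintype.card ι)
    rw [sub_sub_cancel] at hg
    rw [← hg, Finset.mul_sum]
    refine Finset.sum_congr rfl fun k _ => ?_
    have : (k : ℝ) + 1 ≠ 0 := by positivity
    push_cast
    field_simp
  · intro t ht
    have h1 : Real.exp (-t) ≤ 1 := Real.exp_le_one_iff.mpr (neg_nonpos.mpr (le_of_lt ht))
    exact sub_nonneg.mpr (pow_le_one₀ (by linarith) (by linarith [Real.exp_pos (-t)]))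
  · rw [harmonic]
    push_cast
    refine tendsto_finsetSum _ fun k _ => ?_
    have h := (((Real.tendsto_exp_neg_atTop_nhds_zero).const_sub 1).pow (k + 1)).div_const
      ((k : ℝ) + 1)
    simpa using h

theorem iIndepFun_coord_expVector :
    ProbabilityTheory.iIndepFun (fun (i : ι) (x : ι → ℝ) => x i) (expVector ι) :=
  ProbabilityTheory.iIndepFun_pi (X := fun _ : ι => id) fun _ => aemeasurable_id

theorem map_coord_expVector (i : ι) :
    (expVector ι).map (fun x => x i) = ProbabilityTheory.expMeasure 1 :=
  (measurePreserving_eval (fun _ : ι => ProbabilityTheory.expMeasure 1) i).map_eq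

theorem expMeasure_singleton (a : ℝ) : ProbabilityTheory.expMeasure 1 {a} = 0 :=
  withDensity_absolutelyContinuous _ _ (measure_singleton a)

/-- Distinct independent exponentials are almost surely different. -/
theorem ae_ne_expVector {i j : ι} (hij : i ≠ j) : ∀ᵐ x ∂expVector ι, x i ≠ x j := by
  have h := (ProbabilityTheory.indepFun_iff_map_prod_eq_prod_map_map
    (measurable_pi_apply i).aemeasurable (measurable_pi_apply j).aemeasurable).mp
    ((iIndepFun_coord_expVector (ι := ι)).indepFun hij)
  rw [map_coord_expVector, map_coord_expVector] at h
  have hd : MeasurableSet {p : ℝ × ℝ | p.1 = p.2} :=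
    measurableSet_eq_fun measurable_fst measurable_snd
  have h0 := congrArg (fun μ : Measure (ℝ × ℝ) => μ {p : ℝ × ℝ | p.1 = p.2}) h
  simp only [Measure.map_apply (show Measurable fun x : ι → ℝ => (x i, x j) by fun_prop) hd] at h0
  rw [ae_iff]
  simp only [ne_eq, not_not]
  refine h0.trans ?_
  rw [Measure.measure_prod_null hd]
  refine Filter.Eventually.of_forall fun a => ?_
  have : Prod.mk a ⁻¹' {p : ℝ × ℝ | p.1 = p.2} = {a} := by
    ext b
    simp [eq_comm]
  change ProbabilityTheory.expMeasure 1 (Prod.mk a ⁻¹' {p : ℝ × ℝ | p.1 = p.2}) = 0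
  rw [this]
  exact expMeasure_singleton a

/-- Conditioning on the variables other than `x i` turns the probability into the Laplace transform
of their sum. -/
theorem expVector_mul_sum_lt [DecidableEq ι] (i : ι) {c : ℝ} (hc : 0 ≤ c) :
    expVector ι {x | c * ∑ j ∈ Finset.univ.erase i, x j < x i} =
      ENNReal.ofReal ((1 / (1 + c)) ^ (Fintype.card ι - 1)) := by
  have hind := iIndepFun_coord_expVector (ι := ι)
  have hms : Measurable fun x : ι → ℝ => (∑ j ∈ Finset.univ.erase i, fun x : ι → ℝ => x j) x := by
    fun_prop
  have h := (ProbabilityTheory.indepFun_iff_map_prod_eq_prod_map_map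
    (f := ∑ j ∈ Finset.univ.erase i, fun x : ι → ℝ => x j)
    hms.aemeasurable (measurable_pi_apply i).aemeasurable).mp
    (hind.indepFun_finsetSum_of_notMem (fun i => measurable_pi_apply i)
      (Finset.notMem_erase i Finset.univ))
  have hs : MeasurableSet {p : ℝ × ℝ | c * p.1 < p.2} :=
    measurableSet_lt (by fun_prop) (by fun_prop)
  have h0 := congrArg (fun μ : Measure (ℝ × ℝ) => μ {p : ℝ × ℝ | c * p.1 < p.2}) h
  simp only [Measure.map_apply (hms.prodMk (measurable_pi_apply i)) hs] at h0
  rw [map_coord_expVector, Measure.prod_apply hs,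
    lintegral_map (measurable_measure_prodMk_left hs) hms] at h0
  have hset : {x : ι → ℝ | c * ∑ j ∈ Finset.univ.erase i, x j < x i} =
      (fun x : ι → ℝ => ((∑ j ∈ Finset.univ.erase i, fun x : ι → ℝ => x j) x, x i)) ⁻¹'
        {p : ℝ × ℝ | c * p.1 < p.2} := by
    ext x
    simp
  rw [hset, h0]
  have hexp : ∀ᵐ x ∂expVector ι, ProbabilityTheory.expMeasure 1
      (Prod.mk ((∑ j ∈ Finset.univ.erase i, fun x : ι → ℝ => x j) x) ⁻¹'
        {p : ℝ × ℝ | c * p.1 < p.2}) =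
      ∏ j ∈ Finset.univ.erase i, ENNReal.ofReal (Real.exp (-(c * x j))) := by
    filter_upwards [ae_pos_expVector (ι := ι)] with x hx
    have : Prod.mk ((∑ j ∈ Finset.univ.erase i, fun x : ι → ℝ => x j) x) ⁻¹'
        {p : ℝ × ℝ | c * p.1 < p.2} = Set.Ioi (c * ∑ j ∈ Finset.univ.erase i, x j) := by
      ext y
      simp
    rw [this, expMeasure_one_Ioi (mul_nonneg hc (Finset.sum_nonneg fun j _ => (hx j).le)),
      ← ENNReal.ofReal_prod_of_nonneg fun j _ => (Real.exp_pos _).le, ← Real.exp_sum,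
      Finset.sum_neg_distrib, Finset.mul_sum]
  have hprod := ProbabilityTheory.lintegral_prod_eq_prod_lintegral_of_indepFun
    (Finset.univ.erase i) (fun j (x : ι → ℝ) => ENNReal.ofReal (Real.exp (-(c * x j))))
    (hind.comp (fun _ y => ENNReal.ofReal (Real.exp (-(c * y)))) fun _ => by fun_prop)
    (fun j => by fun_prop)
  rw [lintegral_congr_ae hexp, hprod]
  have hj : ∀ j : ι, ∫⁻ x, ENNReal.ofReal (Real.exp (-(c * x j))) ∂expVector ι =
      ENNReal.ofReal (1 / (1 + c)) := by
    intro j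
    rw [← lintegral_exp_neg_mul_expMeasure hc, ← map_coord_expVector j,
      lintegral_map (by fun_prop) (by fun_prop)]
  rw [Finset.prod_congr rfl fun j _ => hj j, Finset.prod_const,
    Finset.card_erase_of_mem (Finset.mem_univ i), Finset.card_univ,
    ENNReal.ofReal_pow (by positivity)]

end

/-! ### Amplitudes of Haar-random states -/

/-- A Gaussian vector is its length times an independent Haar-random direction. In terms of squared
moduli: independent exponentials `x` have the joint law of `(∑ w, x w) * |χ_z|²`, with `χ` a
Haar-random state independent of `x`. -/
theorem lintegral_expVector_eq_lintegral_haarState {n : ℕ} {G : (Bits n → ℝ) → ENNReal}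
    (hG : Measurable G) :
    ∫⁻ x, G x ∂expVector (Bits n) =
      ∫⁻ x, ∫⁻ χ, G (fun z => (∑ w, x w) * ‖χ.1 z‖ ^ 2) ∂haarState n ∂expVector (Bits n) := by
  have hsq : Measurable fun (v : Bits n → ℂ) z => ‖v z‖ ^ 2 := by fun_prop
  have hmul : Measurable fun p : QUnitary n × (Bits n → ℂ) => p.1.1.mulVec p.2 :=
    ((continuous_subtype_val.comp continuous_fst).matrix_mulVec continuous_snd).measurable
  have hχ : Measurable fun p : (Bits n → ℝ) × QState n =>
      G fun z => (∑ w, p.1 w) * ‖p.2.1 z‖ ^ 2 := by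
    refine hG.comp (measurable_pi_lambda _ fun z => Continuous.measurable ?_)
    fun_prop
  rw [← map_norm_sq_gaussianVector, lintegral_map hG hsq,
    lintegral_map hχ.lintegral_prod_right' hsq]
  have hU : ∀ U : QUnitary n, ∫⁻ v, G (fun z => ‖v z‖ ^ 2) ∂gaussianVector (Bits n) =
      ∫⁻ v, G (fun z => ‖U.1.mulVec v z‖ ^ 2) ∂gaussianVector (Bits n) := by
    intro U
    conv_lhs => rw [← map_mulVec_gaussianVector U]
    exact lintegral_map (hG.comp hsq) (measurable_mulVec _)
  -- By invariance, the Gaussian vector may first be rotated by an independent Haar-random unitary.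
  calc _ = ∫⁻ _U : QUnitary n, ∫⁻ v, G (fun z => ‖v z‖ ^ 2) ∂gaussianVector (Bits n)
        ∂haarUnitary n := by simp
    _ = ∫⁻ U : QUnitary n, ∫⁻ v, G (fun z => ‖U.1.mulVec v z‖ ^ 2) ∂gaussianVector (Bits n)
        ∂haarUnitary n := lintegral_congr hU
    _ = ∫⁻ v, ∫⁻ U : QUnitary n, G (fun z => ‖U.1.mulVec v z‖ ^ 2) ∂haarUnitary n
        ∂gaussianVector (Bits n) :=
      lintegral_lintegral_swap ((hG.comp hsq).comp hmul).aemeasurable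
    _ = _ := by
      refine lintegral_congr fun v => ?_
      -- For fixed `v = ‖v‖ ψ`, the vector `U v = ‖v‖ (U ψ)` has a Haar-random direction.
      obtain ⟨ψ, hψ⟩ : ∃ ψ : QState n, v = (√(∑ w, ‖v w‖ ^ 2) : ℂ) • ψ.1.ofLp := by
        by_cases hv : v = 0
        · exact ⟨zeroState n, by simp [hv]⟩
        · have hnorm : ‖(WithLp.toLp 2 v : EuclideanSpace ℂ (Bits n))‖ = √(∑ w, ‖v w‖ ^ 2) :=
            EuclideanSpace.norm_eq _
          have hne : (WithLp.toLp 2 v : EuclideanSpace ℂ (Bits n)) ≠ 0 := by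
            simpa using hv
          have hne' := norm_ne_zero_iff.mpr hne
          refine ⟨⟨((√(∑ w, ‖v w‖ ^ 2) : ℝ) : ℂ)⁻¹ • WithLp.toLp 2 v, ?_⟩, ?_⟩
          · rw [mem_sphere_zero_iff_norm, norm_smul, norm_inv, ← hnorm, Complex.norm_real,
              norm_norm,
              inv_mul_cancel₀ hne']
          · have : ((√(∑ w, ‖v w‖ ^ 2) : ℝ) : ℂ) ≠ 0 := by
              rw [← hnorm]; exact_mod_cast hne'
            simp [smul_smul, mul_inv_cancel₀ this]
      have hv := lintegral_map (μ := haarUnitary n)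
        (hχ.comp (measurable_prodMk_left (x := fun z => ‖v z‖ ^ 2))) (measurable_applyU_left ψ)
      rw [map_applyU_haarUnitary] at hv
      refine Eq.trans ?_ hv.symm
      refine lintegral_congr fun U => congrArg G (funext fun z => ?_)
      have hs : 0 ≤ ∑ w, ‖v w‖ ^ 2 := Finset.sum_nonneg fun _ _ => sq_nonneg _
      conv_lhs => rw [hψ]
      rw [Matrix.mulVec_smul, Pi.smul_apply, norm_smul, mul_pow, Complex.norm_real,
        Real.norm_of_nonneg (Real.sqrt_nonneg _), Real.sq_sqrt hs]
      rfl

/-- Events on the squared moduli that ignore a common positive factor have the same probability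
for a Haar-random state as for independent exponentials. -/
theorem haarState_eq_expVector {n : ℕ} {S : Set (Bits n → ℝ)} (hS : MeasurableSet S)
    (hinv : ∀ (r : ℝ) (x : Bits n → ℝ), 0 < r → ((fun z => r * x z) ∈ S ↔ x ∈ S)) :
    haarState n {χ | (fun z => ‖χ.1 z‖ ^ 2) ∈ S} = expVector (Bits n) S := by
  have hm : Measurable fun (χ : QState n) z => ‖χ.1 z‖ ^ 2 :=
    measurable_pi_lambda _ fun z => Continuous.measurable (by fun_prop)
  have h := lintegral_expVector_eq_lintegral_haarState (n := n)
    (G := S.indicator 1) (measurable_one.indicator hS)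
  rw [lintegral_indicator_one hS] at h
  rw [h]
  symm
  calc _ = ∫⁻ x, haarState n {χ | (fun z => ‖χ.1 z‖ ^ 2) ∈ S} ∂expVector (Bits n) := by
        refine lintegral_congr_ae ?_
        filter_upwards [ae_pos_expVector (ι := Bits n)] with x hx
        have hpos : 0 < ∑ w, x w := Finset.sum_pos (fun w _ => hx w) Finset.univ_nonempty
        refine Eq.trans ?_ (lintegral_indicator_one (hm hS))
        refine lintegral_congr fun χ => ?_
        have hiff := hinv _ (fun z => ‖χ.1 z‖ ^ 2) hpos
        by_cases hχ : (fun z => ‖χ.1 z‖ ^ 2) ∈ S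
        · exact (Set.indicator_of_mem (hiff.mpr hχ) _).trans
            (Set.indicator_of_mem (s := {χ : QState n | (fun z => ‖χ.1 z‖ ^ 2) ∈ S}) hχ 1).symm
        · exact (Set.indicator_of_notMem (fun h => hχ (hiff.mp h)) _).trans
            (Set.indicator_of_notMem (s := {χ : QState n | (fun z => ‖χ.1 z‖ ^ 2) ∈ S}) hχ 1).symm
    _ = _ := by simp

theorem card_bits (n : ℕ) : Fintype.card (Bits n) = 2 ^ n := by simp

/-- The squared modulus of an amplitude of a Haar-random state exceeds `t` with probability
`(1 - t) ^ (2 ^ n - 1)`. -/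
theorem haarState_lt_norm_sq {n : ℕ} (z : Bits n) {t : ℝ} (h0 : 0 ≤ t) (h1 : t < 1) :
    haarState n {χ | t < ‖χ.1 z‖ ^ 2} = ENNReal.ofReal ((1 - t) ^ (2 ^ n - 1)) := by
  have hpos : 0 < 1 - t := sub_pos.mpr h1
  have h := haarState_eq_expVector (n := n) (S := {x | t * ∑ w, x w < x z})
    (measurableSet_lt (by fun_prop) (by fun_prop)) (fun r x hr => by
      simp only [Set.mem_ofPred_eq]
      rw [← Finset.mul_sum, mul_left_comm]
      exact mul_lt_mul_iff_right₀ hr)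
  simp only [Set.mem_ofPred_eq, sum_norm_sq_state, mul_one] at h
  -- Move the contribution of `x z` to the sum over to the right-hand side.
  have hset : {x : Bits n → ℝ | t * ∑ w, x w < x z} =
      {x | t / (1 - t) * ∑ w ∈ Finset.univ.erase z, x w < x z} := by
    ext x
    simp only [Set.mem_ofPred_eq]
    rw [← Finset.add_sum_erase _ _ (Finset.mem_univ z), div_mul_eq_mul_div, div_lt_iff₀ hpos]
    constructor <;> intro <;> linarith
  rw [h, hset, expVector_mul_sum_lt z (div_nonneg h0 hpos.le), card_bits]
  congr 2
  field_simp
  ring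

theorem ae_ne_norm_sq_haarState {n : ℕ} {z w : Bits n} (hzw : z ≠ w) :
    ∀ᵐ χ ∂haarState n, ‖χ.1 z‖ ^ 2 ≠ ‖χ.1 w‖ ^ 2 := by
  have h := haarState_eq_expVector (n := n) (S := {x | x z = x w})
    (measurableSet_eq_fun (by fun_prop) (by fun_prop)) (fun r x hr => by
      simp [hr.ne'])
  have h' := ae_iff.mp (ae_ne_expVector hzw)
  simp only [ne_eq, not_not] at h'
  rw [ae_iff]
  simp only [ne_eq, not_not]
  exact h.trans h'

theorem bddAbove_norm_sq {n : ℕ} (χ : QState n) : BddAbove (Set.range fun z => ‖χ.1 z‖ ^ 2) :=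
  (Set.finite_range _).bddAbove

theorem measurable_iSup_norm_sq (n : ℕ) : Measurable fun χ : QState n => ⨆ z, ‖χ.1 z‖ ^ 2 :=
  Measurable.iSup fun z => Continuous.measurable (by fun_prop)

/-- The likeliest outcome of measuring a Haar-random state has expected probability
`H_N / N`, where `N = 2 ^ n`. -/
theorem integral_iSup_norm_sq_haarState (n : ℕ) :
    ∫ χ, ⨆ z, ‖χ.1 z‖ ^ 2 ∂haarState n = ((harmonic (2 ^ n) : ℚ) : ℝ) / 2 ^ n := by
  have hnn : ∀ χ : QState n, 0 ≤ ⨆ z, ‖χ.1 z‖ ^ 2 := fun χ => Real.iSup_nonneg fun z => sq_nonneg _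
  have h := lintegral_expVector_eq_lintegral_haarState (n := n)
    (G := fun x => ENNReal.ofReal (⨆ z, x z))
    (Measurable.iSup fun z => measurable_pi_apply z).ennreal_ofReal
  rw [lintegral_iSup_expVector, card_bits] at h
  have hm : Measurable fun χ : QState n => ENNReal.ofReal (⨆ z, ‖χ.1 z‖ ^ 2) :=
    (measurable_iSup_norm_sq n).ennreal_ofReal
  have h2 : ∫⁻ x, ∫⁻ χ, ENNReal.ofReal (⨆ z, (∑ w, x w) * ‖χ.1 z‖ ^ 2) ∂haarState n
      ∂expVector (Bits n) = 2 ^ n * ∫⁻ χ, ENNReal.ofReal (⨆ z, ‖χ.1 z‖ ^ 2) ∂haarState n := by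
    calc _ = ∫⁻ x, (∑ w, ENNReal.ofReal (x w)) *
          ∫⁻ χ, ENNReal.ofReal (⨆ z, ‖χ.1 z‖ ^ 2) ∂haarState n ∂expVector (Bits n) := by
          refine lintegral_congr_ae ?_
          filter_upwards [ae_pos_expVector (ι := Bits n)] with x hx
          have hs : 0 ≤ ∑ w, x w := Finset.sum_nonneg fun w _ => (hx w).le
          rw [← ENNReal.ofReal_sum_of_nonneg fun w _ => (hx w).le, ← lintegral_const_mul _ hm]
          refine lintegral_congr fun χ => ?_
          rw [← Real.mul_iSup_of_nonneg hs, ENNReal.ofReal_mul hs]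
      _ = _ := by
          rw [lintegral_mul_const _ (by fun_prop), lintegral_finsetSum _ fun w _ => by fun_prop]
          simp [lintegral_coord_expVector]
  rw [h2] at h
  rw [integral_eq_lintegral_of_nonneg_ae (Filter.Eventually.of_forall hnn)
    (measurable_iSup_norm_sq n).aestronglyMeasurable, eq_div_iff (by positivity)]
  have h3 := congrArg ENNReal.toReal h
  rw [ENNReal.toReal_ofReal (by
    rw [harmonic]; push_cast; exact Finset.sum_nonneg fun _ _ => by positivity)] at h3
  rw [h3, ENNReal.toReal_mul, mul_comm]
  simp

/-! ### Conditional expectation of an outcome probability -/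

theorem norm_unitary_entry_le_one {n : ℕ} (U : QUnitary n) (z j : Bits n) : ‖U.1 z j‖ ≤ 1 :=
  entry_norm_bound_of_unitary U.2 z j

theorem continuous_unitary_entry {n : ℕ} (z j : Bits n) :
    Continuous fun U : QUnitary n => U.1 z j :=
  (continuous_apply j).comp ((continuous_apply z).comp continuous_subtype_val)

/-- The unitary that permutes the computational basis by `σ`. -/
noncomputable def permUnitary {n : ℕ} (σ : Equiv.Perm (Bits n)) : QUnitary n :=
  ⟨(1 : Matrix (Bits n) (Bits n) ℂ).submatrix id σ, by
    rw [Matrix.mem_unitaryGroup_iff', Matrix.star_eq_conjTranspose, Matrix.conjTranspose_submatrix,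
      Matrix.conjTranspose_one, ← Matrix.submatrix_mul _ _ _ _ _ Function.bijective_id,
      Matrix.mul_one, Matrix.submatrix_one_equiv]⟩

theorem mul_permUnitary_apply {n : ℕ} (U : QUnitary n) (σ : Equiv.Perm (Bits n)) (z j : Bits n) :
    (U * permUnitary σ).1 z j = U.1 z (σ j) := by
  simp [permUnitary, Matrix.mul_apply, Matrix.one_apply]

/-- The unitary that flips the sign of the `k`-th basis vector. -/
noncomputable def flipUnitary {n : ℕ} (k : Bits n) : QUnitary n :=
  ⟨Matrix.diagonal fun j => if j = k then -1 else 1, by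
    rw [Matrix.mem_unitaryGroup_iff', Matrix.star_eq_conjTranspose, Matrix.diagonal_conjTranspose,
      Matrix.diagonal_mul_diagonal, ← Matrix.diagonal_one]
    congr 1
    ext j
    by_cases h : j = k <;> simp [h]⟩

theorem mul_flipUnitary_apply {n : ℕ} (U : QUnitary n) (k z j : Bits n) :
    (U * flipUnitary k).1 z j = U.1 z j * if j = k then -1 else 1 := by
  simp [flipUnitary]

theorem applyU_mul_of_fix {n : ℕ} (U W : QUnitary n)
    (hW : ∀ z, (U * W).1 z (fun _ => false) = U.1 z fun _ => false) :
    applyU (U * W) (zeroState n) = applyU U (zeroState n) := by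
  ext z
  rw [applyU_zeroState_apply, applyU_zeroState_apply, hW]

section

variable {n : ℕ} {g : QState n → ℝ} {C : ℝ}

theorem integrable_mul_unitary_entries (hg : Measurable g) (hC : ∀ χ, ‖g χ‖ ≤ C) (z j k : Bits n) :
    Integrable (fun U : QUnitary n => (g (applyU U (zeroState n)) : ℂ) *
      (U.1 z j * star (U.1 z k))) (haarUnitary n) := by
  refine Integrable.of_bound (C := C) (Measurable.aestronglyMeasurable ?_)
    (Filter.Eventually.of_forall fun U => ?_)
  · have h1 : Measurable fun U : QUnitary n => (g (applyU U (zeroState n)) : ℂ) :=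
      Complex.measurable_ofReal.comp (hg.comp (measurable_applyU_left _))
    exact h1.mul ((continuous_unitary_entry z j).mul (continuous_unitary_entry z k).star).measurable
  · rw [norm_mul, norm_mul, norm_star, Complex.norm_real]
    have h := mul_le_one₀ (norm_unitary_entry_le_one U z j) (norm_nonneg _)
      (norm_unitary_entry_le_one U z k)
    exact (mul_le_of_le_one_right (norm_nonneg _) h).trans (hC _)

/-- Flipping the sign of one column, other than that of `|0ⁿ⟩`, shows that entries in distinct
columns are uncorrelated given the column of `|0ⁿ⟩`. -/
theorem integral_mul_unitary_entries_of_ne (z : Bits n) {j k : Bits n} (hjk : j ≠ k) :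
    ∫ U : QUnitary n, (g (applyU U (zeroState n)) : ℂ) * (U.1 z j * star (U.1 z k))
      ∂haarUnitary n = 0 := by
  -- Since `j ≠ k`, one of the two is not the column of `|0ⁿ⟩`; call it `l`.
  obtain ⟨l, hl0, hl⟩ : ∃ l : Bits n, l ≠ (fun _ => false) ∧ (l = j ∧ l ≠ k ∨ l ≠ j ∧ l = k) := by
    by_cases hj : j = fun _ => false
    · exact ⟨k, fun hk => hjk (hj.trans hk.symm), Or.inr ⟨hjk.symm, rfl⟩⟩
    · exact ⟨j, hj, Or.inl ⟨rfl, hjk⟩⟩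
  refine integral_eq_zero_of_mul_right_eq_neg (g := flipUnitary l) fun U => ?_
  rw [applyU_mul_of_fix U _ fun z => by rw [mul_flipUnitary_apply, if_neg hl0.symm, mul_one],
    mul_flipUnitary_apply, mul_flipUnitary_apply]
  rcases hl with ⟨h1, h2⟩ | ⟨h1, h2⟩
  · rw [if_pos h1.symm, if_neg h2.symm]; simp
  · rw [if_neg h1.symm, if_pos h2.symm]; simp

/-- Exchanging two columns, other than that of `|0ⁿ⟩`, shows that their entries are identically
distributed given the column of `|0ⁿ⟩`. -/
theorem integral_mul_norm_sq_entry_eq (z : Bits n) {j k : Bits n} (hj : j ≠ fun _ => false)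
    (hk : k ≠ fun _ => false) :
    ∫ U : QUnitary n, g (applyU U (zeroState n)) * ‖U.1 z j‖ ^ 2 ∂haarUnitary n =
      ∫ U : QUnitary n, g (applyU U (zeroState n)) * ‖U.1 z k‖ ^ 2 ∂haarUnitary n := by
  rw [← integral_mul_right_eq_self _ (permUnitary (Equiv.swap j k))]
  refine integral_congr_ae (Filter.Eventually.of_forall fun U => ?_)
  simp only
  rw [applyU_mul_of_fix U _ fun z => by
    rw [mul_permUnitary_apply, Equiv.swap_apply_of_ne_of_ne hj.symm hk.symm],
    mul_permUnitary_apply, Equiv.swap_apply_left]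

theorem integrable_mul_norm_sq_entry (hg : Measurable g) (hC : ∀ χ, ‖g χ‖ ≤ C) (z j : Bits n) :
    Integrable (fun U : QUnitary n => g (applyU U (zeroState n)) * ‖U.1 z j‖ ^ 2)
      (haarUnitary n) := by
  refine (integrable_mul_unitary_entries hg hC z j j).re.congr
    (Filter.Eventually.of_forall fun U => ?_)
  simp only [RCLike.star_def, Complex.mul_conj']
  norm_cast

/-- The cross terms between distinct columns vanish. -/
theorem integral_mul_norm_sq_applyU_eq_sum (hg : Measurable g) (hC : ∀ χ, ‖g χ‖ ≤ C) (z : Bits n)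
    (ψ : QState n) :
    ∫ U, g (applyU U (zeroState n)) * ‖(applyU U ψ).1 z‖ ^ 2 ∂haarUnitary n =
      ∑ j, ‖ψ.1 j‖ ^ 2 *
        ∫ U : QUnitary n, g (applyU U (zeroState n)) * ‖U.1 z j‖ ^ 2 ∂haarUnitary n := by
  have hexp : ∀ U : QUnitary n,
      ((g (applyU U (zeroState n)) * ‖(applyU U ψ).1 z‖ ^ 2 : ℝ) : ℂ) =
        ∑ j, ∑ k, (ψ.1 j * star (ψ.1 k)) *
          ((g (applyU U (zeroState n)) : ℂ) * (U.1 z j * star (U.1 z k))) := by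
    intro U
    rw [applyU_apply]
    push_cast
    rw [← Complex.mul_conj', map_sum, Finset.sum_mul_sum, Finset.mul_sum]
    refine Finset.sum_congr rfl fun j _ => ?_
    rw [Finset.mul_sum]
    refine Finset.sum_congr rfl fun k _ => ?_
    simp only [map_mul, RCLike.star_def]
    ring
  have hint := integrable_mul_unitary_entries hg hC z
  apply Complex.ofReal_injective
  rw [← integral_complex_ofReal]
  simp_rw [hexp]
  rw [integral_finsetSum _ fun j _ => integrable_finsetSum _ fun k _ => (hint j k).const_mul _]
  push_cast
  refine Finset.sum_congr rfl fun j _ => ?_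
  rw [integral_finsetSum _ fun k _ => (hint j k).const_mul _, Finset.sum_eq_single j]
  · rw [integral_const_mul, ← integral_complex_ofReal, RCLike.star_def, Complex.mul_conj']
    congr 1
    refine integral_congr_ae (Filter.Eventually.of_forall fun U => ?_)
    simp [Complex.mul_conj']
  · intro k _ hk
    rw [integral_const_mul, integral_mul_unitary_entries_of_ne z hk.symm, mul_zero]
  · simp

/-- Given the image `χ` of `|0ⁿ⟩`, the image of `ψ` has the component of `ψ` along `|0ⁿ⟩` in the
direction `χ`, and the rest is spread uniformly over the orthogonal complement of `χ`. -/
theorem integral_mul_norm_sq_applyU_zeroState (hn : 1 ≤ n) (hg : Measurable g)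
    (hC : ∀ χ, ‖g χ‖ ≤ C) (z : Bits n) (ψ : QState n) :
    ∫ U, g (applyU U (zeroState n)) * ‖(applyU U ψ).1 z‖ ^ 2 ∂haarUnitary n =
      fidelity (zeroState n) ψ * ∫ χ, g χ * ‖χ.1 z‖ ^ 2 ∂haarState n +
      (1 - fidelity (zeroState n) ψ) / (2 ^ n - 1) *
        (∫ χ, g χ ∂haarState n - ∫ χ, g χ * ‖χ.1 z‖ ^ 2 ∂haarState n) := by
  set o : Bits n := fun _ => false with ho
  set a : Bits n → ℝ := fun j =>
    ∫ U : QUnitary n, g (applyU U (zeroState n)) * ‖U.1 z j‖ ^ 2 ∂haarUnitary n with ha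
  have hA : ∫ χ, g χ * ‖χ.1 z‖ ^ 2 ∂haarState n = a o := by
    rw [haarState, integral_map (measurable_applyU_left _).aemeasurable]
    · simp only [applyU_zeroState_apply, ha, ho]
    · exact (hg.mul ((continuous_state_apply z).norm.pow 2).measurable).aestronglyMeasurable
  have hB : ∫ χ, g χ ∂haarState n = ∑ j, a j := by
    rw [haarState, integral_map (measurable_applyU_left _).aemeasurable hg.aestronglyMeasurable, ha,
      ← integral_finsetSum _ fun j _ => integrable_mul_norm_sq_entry hg hC z j]
    refine integral_congr_ae (Filter.Eventually.of_forall fun U => ?_)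
    have hrow : ∑ j, ‖U.1 z j‖ ^ 2 = 1 := by
      have h := congrFun (congrFun (Matrix.mem_unitaryGroup_iff.mp U.2) z) z
      simp only [Matrix.mul_apply, Matrix.star_apply, RCLike.star_def, Complex.mul_conj',
        Matrix.one_apply_eq] at h
      exact_mod_cast h
    simp only
    rw [← Finset.mul_sum, hrow, mul_one]
  have hN : (1 : ℝ) < 2 ^ n := one_lt_pow₀ (by norm_num) (by omega)
  obtain ⟨j₀, hj₀⟩ : ∃ j₀ : Bits n, j₀ ≠ o := by
    refine ⟨fun _ => true, fun h => ?_⟩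
    simpa [ho] using congrFun h ⟨0, hn⟩
  have hrest : ∀ j ∈ Finset.univ.erase o, a j = a j₀ := fun j hj =>
    integral_mul_norm_sq_entry_eq z (Finset.ne_of_mem_erase hj) hj₀
  have hcard : ((Finset.univ.erase o).card : ℝ) = 2 ^ n - 1 := by
    rw [Finset.card_erase_of_mem (Finset.mem_univ _), Finset.card_univ, card_bits,
      Nat.cast_sub Nat.one_le_two_pow]
    simp
  have hsum : ∑ j, a j = a o + (2 ^ n - 1) * a j₀ := by
    rw [← Finset.add_sum_erase _ _ (Finset.mem_univ o), Finset.sum_congr rfl hrest,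
      Finset.sum_const, nsmul_eq_mul, hcard]
  have hψ : ∑ j ∈ Finset.univ.erase o, ‖ψ.1 j‖ ^ 2 = 1 - ‖ψ.1 o‖ ^ 2 := by
    have h := sum_norm_sq_state ψ
    rw [← Finset.add_sum_erase _ _ (Finset.mem_univ o)] at h
    linarith
  have hexp : ∑ j, ‖ψ.1 j‖ ^ 2 * a j =
      ‖ψ.1 o‖ ^ 2 * a o + (1 - ‖ψ.1 o‖ ^ 2) * a j₀ := by
    rw [← Finset.add_sum_erase _ _ (Finset.mem_univ o), ← hψ, Finset.sum_mul]
    exact congrArg _ (Finset.sum_congr rfl fun j hj => by rw [hrest j hj])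
  rw [integral_mul_norm_sq_applyU_eq_sum hg hC, hA, hB, hsum, fidelity_zeroState]
  refine hexp.trans ?_
  have : (2 : ℝ) ^ n - 1 ≠ 0 := by linarith
  rw [add_sub_cancel_left, ← mul_assoc, div_mul_cancel₀ _ this]

/-- The general case follows by right invariance, moving `φ` to `|0ⁿ⟩`. -/
theorem integral_mul_norm_sq_applyU (hn : 1 ≤ n) (hg : Measurable g)
    (hC : ∀ χ, ‖g χ‖ ≤ C) (z : Bits n) (φ ψ : QState n) :
    ∫ U, g (applyU U φ) * ‖(applyU U ψ).1 z‖ ^ 2 ∂haarUnitary n =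
      fidelity φ ψ * ∫ χ, g χ * ‖χ.1 z‖ ^ 2 ∂haarState n +
      (1 - fidelity φ ψ) / (2 ^ n - 1) *
        (∫ χ, g χ ∂haarState n - ∫ χ, g χ * ‖χ.1 z‖ ^ 2 ∂haarState n) := by
  obtain ⟨W, rfl⟩ := exists_applyU_zeroState φ
  rw [← fidelity_applyU W⁻¹ _ ψ, applyU_inv_applyU,
    ← integral_mul_norm_sq_applyU_zeroState hn hg hC]
  conv_rhs => rw [← integral_mul_right_eq_self _ W]
  simp only [← applyU_mul, mul_assoc, mul_inv_cancel, mul_one]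

end

/-! ### Maximizers -/

theorem measurable_apply_of_countable {α β ι : Type*} [MeasurableSpace α] [MeasurableSpace β]
    [MeasurableSpace ι] [Countable ι] [MeasurableSingletonClass ι] {f : ι → α → β}
    (hf : ∀ i, Measurable (f i)) {b : α → ι} (hb : Measurable b) : Measurable fun a => f (b a) a :=
  (measurable_from_prod_countable_right (f := fun p : ι × α => f p.1 p.2) hf).comp
    (hb.prodMk measurable_id)

/-- A measurable finite family of real functions has a measurable pointwise maximizer. -/
theorem exists_measurable_argmax {α ι : Type*} [MeasurableSpace α] [MeasurableSpace ι] [Fintype ι]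
    [MeasurableSingletonClass ι] [Nonempty ι] {f : ι → α → ℝ} (hf : ∀ i, Measurable (f i)) :
    ∃ b : α → ι, Measurable b ∧ ∀ a i, f i a ≤ f (b a) a := by
  classical
  suffices h : ∀ s : Finset ι, s.Nonempty →
      ∃ b : α → ι, Measurable b ∧ ∀ a, ∀ i ∈ s, f i a ≤ f (b a) a by
    obtain ⟨b, hb, h⟩ := h Finset.univ Finset.univ_nonempty
    exact ⟨b, hb, fun a i => h a i (Finset.mem_univ i)⟩
  intro s hs
  induction hs using Finset.Nonempty.cons_induction with
  | singleton i => exact ⟨fun _ => i, measurable_const, by simp⟩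
  | cons i s hi hs ih =>
    obtain ⟨b, hb, h⟩ := ih
    refine ⟨fun a => if f (b a) a ≤ f i a then i else b a,
      Measurable.ite (measurableSet_le (measurable_apply_of_countable hf hb) (hf i))
        measurable_const hb, fun a j hj => ?_⟩
    rcases Finset.mem_cons.mp hj with rfl | hj
    · beta_reduce
      split_ifs with hle
      · exact le_rfl
      · exact (not_le.mp hle).le
    · beta_reduce
      split_ifs with hle
      · exact (h a j hj).trans hle
      · exact h a j hj

theorem measurable_outcomeProb {n : ℕ} (z : Bits n) :
    Measurable fun p : QState n × QUnitary n => outcomeProb z p.2 p.1 :=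
  ((continuous_state_apply z).norm.pow 2).measurable.comp
    ((continuous_applyU n).measurable.comp measurable_swap)

theorem measurable_fidelity {α : Type*} [MeasurableSpace α] {n : ℕ} {f g : α → QState n}
    (hf : Measurable f) (hg : Measurable g) : Measurable fun a => fidelity (f a) (g a) := by
  unfold fidelity
  fun_prop

theorem exists_isRandomCodebook (n m : ℕ) :
    ∃ P : Protocol n m (Codebook n m), IsRandomCodebook P := by
  have hF : ∀ x : Bits m, Measurable fun p : Codebook n m × QState n => fidelity (p.1 x) p.2 :=
    fun x => measurable_fidelity ((measurable_pi_apply x).comp measurable_fst) measurable_snd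
  have hO : ∀ z : Bits n, Measurable fun p : QState n × QUnitary n => outcomeProb z p.2 p.1 :=
    measurable_outcomeProb
  obtain ⟨a, ha, hamax⟩ := exists_measurable_argmax hF
  obtain ⟨b, hb, hbmax⟩ := exists_measurable_argmax hO
  exact ⟨{ randomness := Measure.pi fun _ : Bits m => haarState n
           isProbabilityMeasure_randomness := inferInstance
           alice := fun φ ψ => a (φ, ψ)
           bob := fun φ x U => b (φ x, U)
           measurable_alice := ha
           measurable_bob := fun x => hb.comp
             (((measurable_pi_apply x).comp measurable_fst).prodMk measurable_snd) },
    ⟨rfl, fun φ ψ x => hamax (φ, ψ) x, fun φ x U z => hbmax (φ x, U) z⟩⟩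

/-- The expected probability of the outcome chosen by Bob. He may break ties as he likes, since for
a Haar-random unitary they almost surely do not occur. -/
theorem integral_outcomeProb_of_forall_le {n : ℕ} (hn : 1 ≤ n) (φ ψ : QState n)
    {β : QUnitary n → Bits n} (hβ : ∀ U z, outcomeProb z U φ ≤ outcomeProb (β U) U φ) :
    ∫ U, outcomeProb (β U) U ψ ∂haarUnitary n =
      fidelity φ ψ * (((harmonic (2 ^ n) : ℚ) : ℝ) / 2 ^ n) +
      (1 - fidelity φ ψ) / (2 ^ n - 1) * (1 - ((harmonic (2 ^ n) : ℚ) : ℝ) / 2 ^ n) := by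
  have hsq : ∀ z : Bits n, Measurable fun χ : QState n => ‖χ.1 z‖ ^ 2 := fun z =>
    ((continuous_state_apply z).norm.pow 2).measurable
  obtain ⟨b, hb, hbmax⟩ := exists_measurable_argmax hsq
  have hmax : ∀ χ : QState n, ⨆ z, ‖χ.1 z‖ ^ 2 = ‖χ.1 (b χ)‖ ^ 2 := fun χ =>
    le_antisymm (ciSup_le (hbmax χ)) (le_ciSup (bddAbove_norm_sq χ) (b χ))
  have hties : ∀ᵐ χ ∂haarState n, ∀ z w : Bits n, z ≠ w → ‖χ.1 z‖ ^ 2 ≠ ‖χ.1 w‖ ^ 2 := by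
    simp only [ae_all_iff]
    exact fun z w hzw => ae_ne_norm_sq_haarState hzw
  rw [← map_applyU_haarUnitary φ] at hties
  -- So almost surely `β U` depends on `U` only through `U φ`, as `b (U φ)`.
  have hβb : ∀ᵐ U ∂haarUnitary n, β U = b (applyU U φ) := by
    filter_upwards [ae_of_ae_map (measurable_applyU_left φ).aemeasurable hties] with U hU
    by_contra hne
    exact hU _ _ hne (le_antisymm (hbmax _ _) (hβ U _))
  -- The indicator of the event that the outcome `z` is chosen.
  let g : Bits n → QState n → ℝ := fun z χ => if b χ = z then 1 else 0
  have hg : ∀ z, Measurable (g z) := fun z =>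
    Measurable.ite (hb (measurableSet_singleton z)) measurable_const measurable_const
  have hg1 : ∀ z χ, ‖g z χ‖ ≤ 1 := by
    intro z χ
    simp only [g]
    split_ifs <;> simp
  have hsum : ∀ (χ : QState n) (f : Bits n → ℝ), ∑ z, g z χ * f z = f (b χ) := by
    intro χ f
    simp [g]
  have hint : ∀ z, Integrable (fun χ : QState n => g z χ * ‖χ.1 z‖ ^ 2) (haarState n) := by
    intro z
    refine Integrable.of_bound (C := 1) ((hg z).mul (hsq z)).aestronglyMeasurable
      (Filter.Eventually.of_forall fun χ => ?_)
    rw [norm_mul]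
    refine mul_le_one₀ (hg1 z χ) (norm_nonneg _) ?_
    rw [Real.norm_of_nonneg (sq_nonneg _)]
    exact norm_sq_state_le_one z χ
  have hint' : ∀ z, Integrable (g z) (haarState n) := fun z =>
    Integrable.of_bound (C := 1) (hg z).aestronglyMeasurable
      (Filter.Eventually.of_forall (hg1 z))
  have hintU : ∀ z, Integrable (fun U => g z (applyU U φ) * ‖(applyU U ψ).1 z‖ ^ 2)
      (haarUnitary n) := by
    intro z
    refine Integrable.of_bound (C := 1) (((hg z).comp (measurable_applyU_left φ)).mul
      ((hsq z).comp (measurable_applyU_left ψ))).aestronglyMeasurable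
      (Filter.Eventually.of_forall fun U => ?_)
    rw [norm_mul]
    refine mul_le_one₀ (hg1 z _) (norm_nonneg _) ?_
    rw [Real.norm_of_nonneg (sq_nonneg _)]
    exact norm_sq_state_le_one z _
  have hA : ∑ z, ∫ χ, g z χ * ‖χ.1 z‖ ^ 2 ∂haarState n =
      ((harmonic (2 ^ n) : ℚ) : ℝ) / 2 ^ n := by
    rw [← integral_finsetSum _ fun z _ => hint z, ← integral_iSup_norm_sq_haarState]
    exact integral_congr_ae (Filter.Eventually.of_forall fun χ =>
      (hsum χ fun z => ‖χ.1 z‖ ^ 2).trans (hmax χ).symm)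
  have hB : ∑ z, ∫ χ, g z χ ∂haarState n = 1 := by
    rw [← integral_finsetSum _ fun z _ => hint' z]
    have : ∀ χ, ∑ z, g z χ = 1 := fun χ => by simpa using hsum χ fun _ => 1
    simp [this]
  calc _ = ∫ U, ∑ z, g z (applyU U φ) * ‖(applyU U ψ).1 z‖ ^ 2 ∂haarUnitary n := by
        refine integral_congr_ae (hβb.mono fun U hU => ?_)
        simp only [hU]
        exact (hsum (applyU U φ) fun z => ‖(applyU U ψ).1 z‖ ^ 2).symm
    _ = _ := by
        have hC : 1 - ((harmonic (2 ^ n) : ℚ) : ℝ) / 2 ^ n = ∑ z, (∫ χ, g z χ ∂haarState n -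
            ∫ χ, g z χ * ‖χ.1 z‖ ^ 2 ∂haarState n) := by
          rw [Finset.sum_sub_distrib, hA, hB]
        rw [integral_finsetSum _ fun z _ => hintU z, hC, ← hA,
          Finset.mul_sum, Finset.mul_sum, ← Finset.sum_add_distrib]
        exact Finset.sum_congr rfl fun z _ => integral_mul_norm_sq_applyU hn (hg z) (hg1 z) z φ ψ

/-! ### The best codeword -/

theorem haarState_lt_fidelity {n : ℕ} (ψ : QState n) {t : ℝ} (h0 : 0 ≤ t) (h1 : t < 1) :
    haarState n {φ | t < fidelity φ ψ} = ENNReal.ofReal ((1 - t) ^ (2 ^ n - 1)) := by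
  obtain ⟨W, rfl⟩ := exists_applyU_zeroState ψ
  have hm : MeasurableSet {χ : QState n | t < ‖χ.1 fun _ => false‖ ^ 2} :=
    measurableSet_lt measurable_const ((continuous_state_apply _).norm.pow 2).measurable
  rw [← haarState_lt_norm_sq (fun _ => false) h0 h1]
  conv_rhs => rw [← map_applyU_haarState W⁻¹, Measure.map_apply (measurable_applyU_right _) hm]
  congr 1
  ext φ
  simp only [Set.mem_ofPred_eq, Set.mem_preimage]
  rw [← fidelity_zeroState, ← fidelity_applyU W⁻¹ φ, applyU_inv_applyU, fidelity_comm]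

theorem bddAbove_fidelity {n m : ℕ} (φ : Codebook n m) (ψ : QState n) :
    BddAbove (Set.range fun x => fidelity (φ x) ψ) :=
  (Set.finite_range _).bddAbove

theorem measurable_iSup_fidelity (n m : ℕ) :
    Measurable fun p : Codebook n m × QState n => ⨆ x, fidelity (p.1 x) p.2 :=
  Measurable.iSup fun x =>
    measurable_fidelity ((measurable_pi_apply x).comp measurable_fst) measurable_snd

theorem measurable_iSup_fidelity_left {n : ℕ} (m : ℕ) (ψ : QState n) :
    Measurable fun φ : Codebook n m => ⨆ x, fidelity (φ x) ψ :=
  Measurable.iSup fun x => measurable_fidelity (measurable_pi_apply x) measurable_const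

theorem norm_iSup_fidelity_le_one {n m : ℕ} (φ : Codebook n m) (ψ : QState n) :
    ‖⨆ x, fidelity (φ x) ψ‖ ≤ 1 := by
  rw [Real.norm_of_nonneg (Real.iSup_nonneg fun x => fidelity_nonneg _ _)]
  exact ciSup_le fun x => fidelity_le_one _ _

theorem integrable_iSup_fidelity {n m : ℕ} (ψ : QState n) :
    Integrable (fun φ : Codebook n m => ⨆ x, fidelity (φ x) ψ)
      (Measure.pi fun _ : Bits m => haarState n) :=
  Integrable.of_bound (C := 1)
    (measurable_iSup_fidelity_left m ψ).aestronglyMeasurable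
    (Filter.Eventually.of_forall fun φ => norm_iSup_fidelity_le_one φ ψ)

/-- The expected fidelity of the best codeword, by integrating its tail: the codewords are
independent, so the maximum is at most `t` with probability `(1 - (1 - t) ^ (N - 1)) ^ M`, where
`N = 2 ^ n` and `M = 2 ^ m`. -/
theorem integral_iSup_fidelity {n : ℕ} (m : ℕ) (ψ : QState n) :
    ∫ φ : Codebook n m, ⨆ x, fidelity (φ x) ψ ∂(Measure.pi fun _ : Bits m => haarState n) =
      1 - ∫ u in (0 : ℝ)..1, (1 - u ^ (2 ^ n - 1)) ^ (2 ^ m) := by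
  rw [(integrable_iSup_fidelity ψ).integral_eq_integral_meas_lt
    (Filter.Eventually.of_forall fun φ => Real.iSup_nonneg fun x => fidelity_nonneg _ _)]
  have hlt : ∀ t ∈ Set.Ioo (0 : ℝ) 1, (Measure.pi fun _ : Bits m => haarState n).real
      {φ : Codebook n m | t < ⨆ x, fidelity (φ x) ψ} =
        1 - (1 - (1 - t) ^ (2 ^ n - 1)) ^ (2 ^ m) := by
    intro t ht
    have hm : MeasurableSet {φ : Codebook n m | t < ⨆ x, fidelity (φ x) ψ} :=
      measurableSet_lt measurable_const (measurable_iSup_fidelity_left m ψ)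
    have hs : {φ : Codebook n m | t < ⨆ x, fidelity (φ x) ψ}ᶜ =
        Set.univ.pi fun _ => {χ | t < fidelity χ ψ}ᶜ := by
      ext φ
      simp [ciSup_le_iff (bddAbove_fidelity φ ψ)]
    have hm1 : MeasurableSet {χ : QState n | t < fidelity χ ψ} :=
      measurableSet_lt measurable_const (measurable_fidelity measurable_id measurable_const)
    have h1 : (haarState n).real {χ | t < fidelity χ ψ}ᶜ = 1 - (1 - t) ^ (2 ^ n - 1) := by
      rw [probReal_compl_eq_one_sub hm1, measureReal_def, haarState_lt_fidelity ψ ht.1.le ht.2,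
        ENNReal.toReal_ofReal (pow_nonneg (sub_nonneg.mpr ht.2.le) _)]
    rw [← compl_compl {φ : Codebook n m | t < ⨆ x, fidelity (φ x) ψ},
      probReal_compl_eq_one_sub hm.compl, hs, measureReal_def, Measure.pi_pi, ENNReal.toReal_prod]
    simp only [← measureReal_def, h1, Finset.prod_const, Finset.card_univ, card_bits]
  have hge : ∀ t ∈ Set.Ioi (0 : ℝ) \ Set.Ioo 0 1, (Measure.pi fun _ : Bits m => haarState n).real
      {φ : Codebook n m | t < ⨆ x, fidelity (φ x) ψ} = 0 := by
    intro t ht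
    have h1 : 1 ≤ t := by
      by_contra h
      exact ht.2 ⟨ht.1, not_le.mp h⟩
    have : {φ : Codebook n m | t < ⨆ x, fidelity (φ x) ψ} = ∅ := by
      ext φ
      simp only [Set.mem_ofPred_eq, Set.mem_empty_iff_false, iff_false, not_lt]
      exact (ciSup_le fun x => fidelity_le_one _ _).trans h1
    rw [this, measureReal_empty]
  rw [setIntegral_eq_of_subset_of_forall_sdiff_eq_zero measurableSet_Ioi
      Set.Ioo_subset_Ioi_self hge,
    setIntegral_congr_fun measurableSet_Ioo hlt, ← integral_Ioc_eq_integral_Ioo,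
    ← intervalIntegral.integral_of_le zero_le_one,
    intervalIntegral.integral_comp_sub_left (fun u => 1 - (1 - u ^ (2 ^ n - 1)) ^ (2 ^ m)),
    intervalIntegral.integral_sub (by simp) (Continuous.intervalIntegrable (by fun_prop) _ _)]
  simp

/-! ### The score of the protocol -/

theorem Protocol.measurable_output {n m : ℕ} {Ω : Type} [MeasurableSpace Ω] (P : Protocol n m Ω) :
    Measurable fun p : Ω × QState n × QUnitary n => P.output p.1 p.2.1 p.2.2 :=
  measurable_apply_of_countable (f := fun x (p : Ω × QState n × QUnitary n) => P.bob p.1 x p.2.2)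
    (fun x => (P.measurable_bob x).comp (measurable_fst.prodMk measurable_snd.snd))
    (P.measurable_alice.comp (measurable_fst.prodMk measurable_snd.fst))

theorem Protocol.measurable_outcomeProb_output {n m : ℕ} {Ω : Type} [MeasurableSpace Ω]
    (P : Protocol n m Ω) : Measurable fun p : Ω × QState n × QUnitary n =>
      outcomeProb (P.output p.1 p.2.1 p.2.2) p.2.2 p.2.1 :=
  measurable_apply_of_countable
    (f := fun z (p : Ω × QState n × QUnitary n) => outcomeProb z p.2.2 p.2.1)
    (fun z => (measurable_outcomeProb z).comp measurable_snd) P.measurable_output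

theorem norm_outcomeProb_le_one {n : ℕ} (z : Bits n) (U : QUnitary n) (ψ : QState n) :
    ‖outcomeProb z U ψ‖ ≤ 1 := by
  rw [outcomeProb, Real.norm_of_nonneg (sq_nonneg _)]
  exact norm_sq_state_le_one z _

theorem Protocol.integrable_outcomeProb_output {n m : ℕ} {Ω : Type} [MeasurableSpace Ω]
    (P : Protocol n m Ω) (μ : Measure (Ω × QState n × QUnitary n)) [IsFiniteMeasure μ] :
    Integrable (fun p => outcomeProb (P.output p.1 p.2.1 p.2.2) p.2.2 p.2.1) μ :=
  Integrable.of_bound (C := 1) P.measurable_outcomeProb_output.aestronglyMeasurable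
    (Filter.Eventually.of_forall fun _ => norm_outcomeProb_le_one _ _ _)

/-- Against a Haar-random unitary, the random-codebook protocol attains the value exactly. -/
theorem IsRandomCodebook.integral_outcomeProb_output {n m : ℕ} (hn : 1 ≤ n)
    {P : Protocol n m (Codebook n m)} (hP : IsRandomCodebook P) (𝒮 : Measure (QState n))
    [IsProbabilityMeasure 𝒮] :
    ∫ p, outcomeProb (P.output p.1 p.2.1 p.2.2) p.2.2 p.2.1
      ∂(P.randomness.prod (𝒮.prod (haarUnitary n))) = (1 + codebookEps n m) / 2 ^ n := by
  have hprob := P.isProbabilityMeasure_randomness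
  set H : ℝ := ((harmonic (2 ^ n) : ℚ) : ℝ) with hH
  set J : ℝ := ∫ u in (0 : ℝ)..1, (1 - u ^ (2 ^ n - 1)) ^ (2 ^ m) with hJ
  -- The expected score, as an affine function of the fidelity of the best codeword.
  let G : ℝ → ℝ := fun F => (H / 2 ^ n - 1 / (2 ^ n - 1) * (1 - H / 2 ^ n)) * F +
    1 / (2 ^ n - 1) * (1 - H / 2 ^ n)
  have hU : ∀ (φ : Codebook n m) (ψ : QState n),
      ∫ U, outcomeProb (P.output φ ψ U) U ψ ∂haarUnitary n = G (⨆ x, fidelity (φ x) ψ) := by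
    intro φ ψ
    have hmax : ⨆ x, fidelity (φ x) ψ = fidelity (φ (P.alice φ ψ)) ψ :=
      le_antisymm (ciSup_le (hP.alice_max φ ψ)) (le_ciSup (bddAbove_fidelity φ ψ) _)
    have h := integral_outcomeProb_of_forall_le hn (φ (P.alice φ ψ)) ψ
      (β := fun U => P.output φ ψ U) fun U z => hP.bob_max φ _ U z
    rw [h, hmax]
    simp only [G]
    ring
  have hint := P.integrable_outcomeProb_output (P.randomness.prod (𝒮.prod (haarUnitary n)))
  have hψ : ∀ ψ : QState n, ∫ φ, G (⨆ x, fidelity (φ x) ψ) ∂P.randomness = G (1 - J) := by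
    intro ψ
    rw [hP.randomness_eq, integral_add ((integrable_iSup_fidelity ψ).const_mul _)
      (integrable_const _), integral_const_mul, integral_iSup_fidelity, ← hJ]
    simp [G]
  have hGint : Integrable (fun p : Codebook n m × QState n => G (⨆ x, fidelity (p.1 x) p.2))
      (P.randomness.prod 𝒮) := by
    refine Integrable.add (Integrable.const_mul ?_ _) (integrable_const _)
    exact Integrable.of_bound (C := 1) (measurable_iSup_fidelity n m).aestronglyMeasurable
      (Filter.Eventually.of_forall fun p => norm_iSup_fidelity_le_one p.1 p.2)
  have hN : (1 : ℝ) < 2 ^ n := one_lt_pow₀ (by norm_num) (by omega)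
  calc _ = ∫ φ, ∫ ψ, G (⨆ x, fidelity (φ x) ψ) ∂𝒮 ∂P.randomness := by
        rw [integral_prod _ hint]
        refine integral_congr_ae (Filter.Eventually.of_forall fun φ => ?_)
        have hφ : Integrable (fun q : QState n × QUnitary n =>
            outcomeProb (P.output φ q.1 q.2) q.2 q.1) (𝒮.prod (haarUnitary n)) :=
          Integrable.of_bound (C := 1)
            (P.measurable_outcomeProb_output.comp measurable_prodMk_left).aestronglyMeasurable
            (Filter.Eventually.of_forall fun _ => norm_outcomeProb_le_one _ _ _)
        exact (integral_prod _ hφ).trans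
          (integral_congr_ae (Filter.Eventually.of_forall fun ψ => hU φ ψ))
    _ = ∫ ψ, ∫ φ, G (⨆ x, fidelity (φ x) ψ) ∂P.randomness ∂𝒮 := integral_integral_swap hGint
    _ = G (1 - J) := by simp [hψ]
    _ = _ := by
        have h1 : (2 : ℝ) ^ n - 1 ≠ 0 := by linarith
        simp only [G, codebookEps, ← hH, ← hJ]
        field_simp
        ring

/-- Re-randomization turns a Haar-random state and any independent unitary into a Haar-random state
and an independent Haar-random unitary. -/
theorem measurePreserving_rerandomize (n : ℕ) (𝒰 : Measure (QUnitary n)) [IsProbabilityMeasure 𝒰] :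
    MeasurePreserving
      (fun q : QUnitary n × QState n × QUnitary n => (applyU q.1 q.2.1, q.2.2 * star q.1))
      ((haarUnitary n).prod ((haarState n).prod 𝒰)) ((haarState n).prod (haarUnitary n)) := by
  have hm : Measurable fun q : QUnitary n × QState n × QUnitary n =>
      (applyU q.1 q.2.1, q.2.2 * star q.1) :=
    ((continuous_applyU n).measurable.comp (measurable_fst.prodMk measurable_snd.fst)).prodMk
      (measurable_snd.snd.mul (continuous_star.measurable.comp measurable_fst))
  refine ⟨hm, Measure.ext_of_lintegral _ fun h hh => ?_⟩
  have hk : Measurable fun V : QUnitary n => ∫⁻ ψ, h (ψ, V) ∂haarState n := hh.lintegral_prod_left'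
  have hhm : Measurable fun q : QUnitary n × QState n × QUnitary n =>
      h (applyU q.1 q.2.1, q.2.2 * star q.1) := hh.comp hm
  rw [lintegral_map hh hm, lintegral_prod _ hhm.aemeasurable]
  calc _ = ∫⁻ V, ∫⁻ U, ∫⁻ ψ, h (ψ, U * V⁻¹) ∂haarState n ∂𝒰 ∂haarUnitary n := by
        refine lintegral_congr fun V => ?_
        have hV : Measurable fun q : QState n × QUnitary n => h (applyU V q.1, q.2 * V⁻¹) :=
          hhm.comp measurable_prodMk_left
        refine (lintegral_prod_symm _ hV.aemeasurable).trans (lintegral_congr fun U => ?_)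
        conv_rhs => rw [← map_applyU_haarState V]
        have hq : Measurable fun ψ : QState n => h (ψ, U * V⁻¹) := hh.comp measurable_prodMk_right
        exact (lintegral_map hq (measurable_applyU_right V)).symm
    _ = ∫⁻ U, ∫⁻ V, ∫⁻ ψ, h (ψ, U * V⁻¹) ∂haarState n ∂haarUnitary n ∂𝒰 :=
        lintegral_lintegral_swap
          (hk.comp (measurable_snd.mul measurable_fst.inv)).aemeasurable
    _ = ∫⁻ _U : QUnitary n, ∫⁻ V, ∫⁻ ψ, h (ψ, V) ∂haarState n ∂haarUnitary n ∂𝒰 := by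
        refine lintegral_congr fun U => ?_
        rw [lintegral_inv_eq_self (fun V => ∫⁻ ψ, h (ψ, U * V) ∂haarState n),
          lintegral_mul_left_eq_self (fun V => ∫⁻ ψ, h (ψ, V) ∂haarState n)]
    _ = ∫⁻ V, ∫⁻ ψ, h (ψ, V) ∂haarState n ∂haarUnitary n := by simp
    _ = _ := (lintegral_prod_symm _ hh.aemeasurable).symm

theorem outcomeProb_rerandomize {n : ℕ} (z : Bits n) (U V : QUnitary n) (ψ : QState n) :
    outcomeProb z (U * star V) (applyU V ψ) = outcomeProb z U ψ := by
  have h : star V * V = 1 := inv_mul_cancel V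
  rw [outcomeProb, outcomeProb, ← applyU_mul, mul_assoc, h, mul_one]

theorem Protocol.integral_outcomeProb_rerandomize {n m : ℕ} {Ω : Type} [MeasurableSpace Ω]
    (P : Protocol n m Ω) (𝒰 : Measure (QUnitary n)) [IsProbabilityMeasure 𝒰] :
    ∫ p, outcomeProb (P.rerandomize.output p.1 p.2.1 p.2.2) p.2.2 p.2.1
      ∂(P.rerandomize.randomness.prod ((haarState n).prod 𝒰)) =
    ∫ p, outcomeProb (P.output p.1 p.2.1 p.2.2) p.2.2 p.2.1
      ∂(P.randomness.prod ((haarState n).prod (haarUnitary n))) := by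
  have hprob := P.isProbabilityMeasure_randomness
  have hT := ((MeasurePreserving.id P.randomness).prod (measurePreserving_rerandomize n 𝒰)).comp
    (measurePreserving_prodAssoc P.randomness (haarUnitary n) ((haarState n).prod 𝒰))
  rw [← hT.map_eq, integral_map hT.measurable.aemeasurable
    P.measurable_outcomeProb_output.aestronglyMeasurable]
  refine integral_congr_ae (Filter.Eventually.of_forall fun p => ?_)
  exact (outcomeProb_rerandomize _ p.2.2 p.1.2 p.2.1).symm

end DXHOG

theorem mainTheorem4 (n m : ℕ) (hn : 1 ≤ n) :
    (∃ P : DXHOG.Protocol n m (DXHOG.Codebook n m), DXHOG.IsRandomCodebook P) ∧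
    ∀ P : DXHOG.Protocol n m (DXHOG.Codebook n m), DXHOG.IsRandomCodebook P →
      (∀ 𝒮 : MeasureTheory.Measure (DXHOG.QState n), MeasureTheory.IsProbabilityMeasure 𝒮 →
        P.SolvesDXHOG 𝒮 (DXHOG.haarUnitary n) (DXHOG.codebookEps n m)) ∧
      (∀ 𝒰 : MeasureTheory.Measure (DXHOG.QUnitary n), MeasureTheory.IsProbabilityMeasure 𝒰 →
        P.rerandomize.SolvesDXHOG (DXHOG.haarState n) 𝒰 (DXHOG.codebookEps n m)) := by
  refine ⟨DXHOG.exists_isRandomCodebook n m, fun P hP => ⟨fun 𝒮 h𝒮 => ?_, fun 𝒰 h𝒰 => ?_⟩⟩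
  · exact (hP.integral_outcomeProb_output hn 𝒮).ge
  · exact ((P.integral_outcomeProb_rerandomize 𝒰).trans
      (hP.integral_outcomeProb_output hn (DXHOG.haarState n))).ge
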